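/- Conventions. A function $f$ from the nonnegative integers to the positive integers is *polynomially bounded* if some polynomial-time deterministic Turing machine outputs $1^{f(n)}$ on input $1^n$ for every $n$. A function $c:\mathbb{Z}_{\ge 0}\to[0,1]$ is *polynomial-time computable* if a deterministic Turing machine, on input $(1^n,1^k)$, outputs in time polynomial in $n+k$ an integer $a$ in binary with $|c(n)-a/2^k|\le 2^{-k}$ (this includes all functions with rational values that can be output exactly, as fractions of binary integers, in time polynomial in $n$). Quantum circuits consist of Hadamard, Toffoli and NOT gates, all their qubits are initialized to $|0\rangle$, and a circuit accepts if measuring its designated output qubit at the end gives $1$. For functions $c,s:\mathbb{Z}_{\ge 0}\to[0,1]$, $\mathrm{QCMA}(c,s)$ is the class of promise problems $(A_{\mathrm{yes}},A_{\mathrm{no}})$ for which there are a polynomially bounded function $m$ and circuits $V_{x,w}$ $(x\in\{0,1\}^*,\ w\in\{0,1\}^{m(|x|)})$, whose descriptions are output by a deterministic polynomial-time Turing machine on input $(x,w)$, such that for every $x$: if $x\in A_{\mathrm{yes}}$, then some $w\in\{0,1\}^{m(|x|)}$ makes $V_{x,w}$ accept with probability at least $c(|x|)$; if $x\in A_{\mathrm{no}}$,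 then for every $w\in\{0,1\}^{m(|x|)}$ the circuit $V_{x,w}$ accepts with probability at most $s(|x|)$. Theorem. Let $c:\mathbb{Z}_{\ge 0}\to[0,1]$ be polynomial-time computable and let $s:\mathbb{Z}_{\ge 0}\to[0,1]$ be any function such that, for some polynomially bounded function $q$, $c(n)-s(n)\ge 1/q(n)$ for all $n$. Put $$s'(n)=\tfrac12\bigl(1-(c(n)-s(n))\bigr)\bigl(1+(1+c(n)-s(n))^2\bigr).$$ Then $0\le s'(n)<1$ for all $n$, and $$\mathrm{QCMA}(c,s)\subseteq\mathrm{QCMA}(1,s').$$ -/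

import Mathlib

/-! ### Polynomial-time computation

Deterministic polynomial time is Mathlib's `Turing.TM2ComputableInPolyTime`: a finite multi-stack
Turing machine, counted step by step, whose running time is bounded by a polynomial in the length
of the encoded input. -/

/-- `f` is computed by a deterministic Turing machine in polynomial time, with arguments encoded
by `ea` and values encoded by `eb`. -/
def PolyTimeComputable {α β αΓ βΓ : Type} (ea : α → List αΓ) (eb : β → List βΓ) (f : α → β) :
    Prop :=
  Nonempty (Turing.TM2ComputableInPolyTime ea eb f)

/-- A function `f` from the nonnegative to the positive integers is polynomially bounded if a
polynomial-time Turing machine outputs `1 ^ f n` on input `1 ^ n`. -/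
def PolynomiallyBounded (f : ℕ → ℕ) : Prop :=
  (∀ n, 0 < f n) ∧
    PolyTimeComputable Computability.unaryEncodeNat Computability.unaryEncodeNat f

/-- A pair of binary words, as one word over the disjoint union of two binary alphabets. -/
def encodePair : List Bool × List Bool → List (Bool ⊕ Bool) :=
  (Computability.encodingProd (Computability.encodingList Bool)
    (Computability.encodingList Bool)).encode

/-- A pair of numbers, both in unary. -/
def encodeUnaryPair : ℕ × ℕ → List (Bool ⊕ Bool) :=
  (Computability.encodingProd Computability.unaryEncodingNat
    Computability.unaryEncodingNat).encode

/-- A function `c` from the nonnegative integers to the nonnegative reals is polynomial-time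
computable if, given `n` and a precision `k` (both in unary), a polynomial-time Turing machine
outputs in binary the numerator `a` of a dyadic rational `a / 2 ^ k` that is within `2 ^ (-k)` of
`c n`. Every function whose values are rational numbers that can be output exactly, as fractions of
binary integers, in time polynomial in `n`, is of this kind. -/
def PolyTimeComputableReal (c : ℕ → ℝ) : Prop :=
  ∃ a : ℕ × ℕ → ℕ, PolyTimeComputable encodeUnaryPair Computability.encodeNat a ∧
    ∀ n k : ℕ, |c n - (a (n, k) : ℝ) / 2 ^ k| ≤ 1 / 2 ^ k

/-! ### Quantum circuits over Hadamard, Toffoli and NOT -/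

/-- The gates on `n` qubits: Hadamard and NOT on one qubit, and Toffoli with two distinct control
qubits `i`, `j` and a further target qubit `t`. -/
inductive QGate (n : ℕ) : Type
  | hadamard (i : Fin n) : QGate n
  | not (i : Fin n) : QGate n
  | toffoli (i j t : Fin n) (hij : i ≠ j) (hit : i ≠ t) (hjt : j ≠ t) : QGate n

/-- A vector of the state space of `n` qubits, by its coordinates in the computational basis. -/
abbrev QState (n : ℕ) : Type := (Fin n → Bool) → ℂ

/-- The all-zero basis state. -/
def QState.zero (n : ℕ) : QState n := Pi.single (fun _ => false) 1

/-- The unitary operator of a gate. A gate that permutes the basis states by an involution `π` sends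
the vector `ψ` to `fun b => ψ (π b)`. -/
noncomputable def QGate.apply {n : ℕ} : QGate n → QState n → QState n
  | .hadamard i, ψ => fun b =>
      ((Real.sqrt 2)⁻¹ : ℂ) * (ψ (Function.update b i false) +
        (if b i then -1 else 1) * ψ (Function.update b i true))
  | .not i, ψ => fun b => ψ (Function.update b i (!b i))
  | .toffoli i j t _ _ _, ψ => fun b => ψ (Function.update b t (xor (b t) (b i && b j)))

/-- A quantum circuit: a number of qubits, a list of gates in the order in which they are applied,
and the designated output qubit. -/
structure QCircuit where
  width : ℕ
  gates : List (QGate width)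
  output : Fin width

/-- The state that the circuit produces when all its qubits are initialized to zero. -/
noncomputable def QCircuit.finalState (C : QCircuit) : QState C.width :=
  C.gates.foldl (fun ψ g => g.apply ψ) (QState.zero C.width)

/-- The probability that measuring the output qubit at the end gives one. -/
noncomputable def QCircuit.acceptProb (C : QCircuit) : ℝ :=
  ∑ b : Fin C.width → Bool, if b C.output then ‖C.finalState b‖ ^ 2 else 0

/-- The alphabet of circuit descriptions. -/
inductive CircuitSymbol : Type
  | tick : CircuitSymbol
  | sep : CircuitSymbol
  | hadamard : CircuitSymbol
  | not : CircuitSymbol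
  | toffoli : CircuitSymbol

/-- Numbers within circuit descriptions are in unary and end with `sep`. So the length of a
description bounds the number of gates and the number of qubits. -/
def encodeIndex (i : ℕ) : List CircuitSymbol :=
  List.replicate i .tick ++ [.sep]

/-- The description of a gate: its kind, followed by the qubits it acts on. -/
def QGate.encode {n : ℕ} : QGate n → List CircuitSymbol
  | .hadamard i => .hadamard :: encodeIndex i
  | .not i => .not :: encodeIndex i
  | .toffoli i j t _ _ _ => .toffoli :: (encodeIndex i ++ encodeIndex j ++ encodeIndex t)

/-- The description of a circuit: its number of qubits, its output qubit, its gates in order. -/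
def QCircuit.encode (C : QCircuit) : List CircuitSymbol :=
  encodeIndex C.width ++ encodeIndex C.output ++ C.gates.flatMap QGate.encode

/-! ### Quantum Merlin-Arthur proof systems with classical witnesses -/

/-- A promise problem on binary strings. -/
structure PromiseProblem where
  yes : Set (List Bool)
  no : Set (List Bool)
  disjoint : Disjoint yes no

/-- The pairs of an input `x` and a witness `w` of length `m |x|`. -/
abbrev WitnessPair (m : ℕ → ℕ) : Type :=
  {p : List Bool × List Bool // p.2.length = m p.1.length}

/-- `QCMA c s` is the class of promise problems for which there are a polynomially bounded witness
length `m` and a family of circuits `V (x, w)`, for `w` of length `m |x|`, such that a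
polynomial-time Turing machine outputs the description of `V (x, w)` on input `(x, w)`, some witness
is accepted with probability at least `c |x|` if `x` is a yes-instance, and every witness is
accepted with probability at most `s |x|` if `x` is a no-instance. -/
def QCMA (c s : ℕ → ℝ) : Set PromiseProblem :=
  {A | ∃ m : ℕ → ℕ, PolynomiallyBounded m ∧
    ∃ V : WitnessPair m → QCircuit,
      PolyTimeComputable (fun p : WitnessPair m => encodePair p.1) QCircuit.encode V ∧
      ∀ x : List Bool,
        (x ∈ A.yes → ∃ (w : List Bool) (hw : w.length = m x.length),
          c x.length ≤ (V ⟨(x, w), hw⟩).acceptProb) ∧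
        (x ∈ A.no → ∀ (w : List Bool) (hw : w.length = m x.length),
          (V ⟨(x, w), hw⟩).acceptProb ≤ s x.length)}

/-! ### Timed runs of multi-stack machines -/

/-! Merlin is asked to reveal the acceptance probability, so that it can be corrected to exactly one
half. Over Hadamard, Toffoli and NOT every amplitude is an integer times a power of 1/√2, so a
circuit with at most `l` gates accepts with probability `N / 2 ^ l` (`exists_acceptProb_eq`). Beside
the old witness, the new one contains the `l` binary digits of a number `v`, honestly `v = 2 ^ l -
N`. With a fair coin, `mixture` outputs either the result of `V` or a bit that is one with
probability `v / 2 ^ l`, made from the digits by coin tosses (`prob_ladder`). If `V` accepts with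
probability p, the mixture outputs one with probability P = (p + v / 2 ^ l) / 2, which is exactly
1/2 for honest digits.

Rewinding turns 1/2 into certainty (`acceptProb_rewind`): run the gates U, change the sign where the
output is one (Z), undo U, and accept unless the initial state is back. The amplitude of the initial
state is then ⟨U0, Z U0⟩ = 1 - 2P, so the acceptance probability is 1 - (1 - 2P)² = 1 - (1 - p - v /
2 ^ l)².

A dishonest Merlin would use `v` to lift a small p to the balance. Therefore a classical test, made
before the circuit is written down, requires v / 2 ^ l ≤ 1 - c up to rounding (`compare_iff`);
honest digits pass because p ≥ c. If p ≤ s, the test gives 1 - p - v / 2 ^ l ≥ δ - ε, where δ = c -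
s, while the bound to be shown is 1 - δ²(1 + δ) / 2 (`soundness_eq`). The allowance δ²(1 - δ) / 2
between this and 1 - δ² absorbs the rounding error ε, except when δ is so close to 1 that the test
forces v = 0 (`acceptProb_perfect_le`).

What remains is that the new descriptions are computable in polynomial time. Multi-stack machines
are closed under composition, joint execution on one input, and iteration over a list with
intermediate results of polynomial length (`PolyTimeComputable.comp`, `PolyTimeComputable.fork`,
`PolyTimeComputable.foldr`). Together with finite-state transducers this yields a calculus of
computable words, `WordComputable`, in which the new description is assembled from the old one. -/

namespace PolyTime

open Turing Function

/-- `f` leads from the first configuration to the second in at most the given number of steps. -/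
inductive StepsTo {C : Type*} (f : C → Option C) : ℕ → C → C → Prop
  | refl (n : ℕ) (c : C) : StepsTo f n c c
  | head {n : ℕ} {a b c : C} : f a = some b → StepsTo f n b c → StepsTo f (n + 1) a c

namespace StepsTo

variable {C : Type*} {f : C → Option C}

theorem mono {n m : ℕ} {a b : C} (h : StepsTo f n a b) (hnm : n ≤ m) : StepsTo f m a b := by
  induction h generalizing m with
  | refl n c => exact .refl _ _
  | head h1 _ ih =>
    obtain ⟨m, rfl⟩ : ∃ m', m = m' + 1 := ⟨m - 1, by omega⟩
    exact .head h1 (ih (by omega))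

theorem trans {n m : ℕ} {a b c : C} (h : StepsTo f n a b) (h' : StepsTo f m b c) :
    StepsTo f (n + m) a c := by
  induction h with
  | refl n c => exact h'.mono (by omega)
  | head h1 _ ih => exact (StepsTo.head h1 (ih h')).mono (by omega)

theorem single {a b : C} (h : f a = some b) : StepsTo f 1 a b := .head h (.refl 0 b)

theorem iterate_none (n : ℕ) : (flip bind f)^[n] (none : Option C) = none := by
  induction n with
  | zero => rfl
  | succ n ih => rw [iterate_succ_apply]; exact ih

theorem of_iterate {n : ℕ} {a b : C} (h : (flip bind f)^[n] (some a) = some b) :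
    StepsTo f n a b := by
  induction n generalizing a with
  | zero => obtain rfl : a = b := by simpa using h
            exact .refl _ _
  | succ n ih =>
    rw [iterate_succ_apply] at h
    cases hfa : f a with
    | none =>
      have : flip bind f (some a) = none := hfa
      rw [this, iterate_none] at h
      cases h
    | some c =>
      have : flip bind f (some a) = some c := hfa
      rw [this] at h
      exact .head hfa (ih h)

theorem exists_iterate {n : ℕ} {a b : C} (h : StepsTo f n a b) :
    ∃ t ≤ n, (flip bind f)^[t] (some a) = some b := by
  induction h with
  | refl n c => exact ⟨0, by omega, rfl⟩
  | head h1 _ ih =>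
    obtain ⟨t, ht, h⟩ := ih
    refine ⟨t + 1, by omega, ?_⟩
    rw [iterate_succ_apply]
    have : flip bind f (some _) = some _ := h1
    rw [this, h]

end StepsTo

theorem initList_eq (tm : FinTM2) (l : List (tm.Γ tm.k₀)) :
    initList tm l = ⟨some tm.main, tm.initialState, update (fun _ => []) tm.k₀ l⟩ := by
  unfold initList
  congr 1
  funext k
  by_cases h : k = tm.k₀
  · subst h; simp
  · simp [h]

/-- A machine that halts properly has restored its internal state and emptied every stack except the
output stack. This is why the programs below reset their state and drain their stacks, and why a
subroutine can be started again. -/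
theorem haltList_eq (tm : FinTM2) (l : List (tm.Γ tm.k₁)) :
    haltList tm l = ⟨none, tm.initialState, update (fun _ => []) tm.k₁ l⟩ := by
  unfold haltList
  congr 1
  funext k
  by_cases h : k = tm.k₁
  · subst h; simp
  · simp [h]

theorem stepsTo_of_outputs {tm : FinTM2} {l : List (tm.Γ tm.k₀)} {l' : List (tm.Γ tm.k₁)} {n : ℕ}
    (h : TM2OutputsInTime tm l (some l') n) :
    StepsTo (TM2.step tm.m) n ⟨some tm.main, tm.initialState, update (fun _ => []) tm.k₀ l⟩
      ⟨none, tm.initialState, update (fun _ => []) tm.k₁ l'⟩ := by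
  rw [← initList_eq, ← haltList_eq]
  exact (StepsTo.of_iterate h.evals_in_steps).mono h.steps_le_m

theorem outputs_of_stepsTo {tm : FinTM2} {l : List (tm.Γ tm.k₀)} {l' : List (tm.Γ tm.k₁)} {n : ℕ}
    (h : StepsTo (TM2.step tm.m) n
      ⟨some tm.main, tm.initialState, update (fun _ => []) tm.k₀ l⟩
      ⟨none, tm.initialState, update (fun _ => []) tm.k₁ l'⟩) :
    Nonempty (TM2OutputsInTime tm l (some l') n) := by
  rw [← initList_eq, ← haltList_eq] at h
  obtain ⟨t, ht, h⟩ := h.exists_iterate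
  exact ⟨⟨⟨t, h⟩, ht⟩⟩

theorem eval_mono (p : Polynomial ℕ) {a b : ℕ} (h : a ≤ b) : p.eval a ≤ p.eval b := by
  rw [Polynomial.eval_eq_sum, Polynomial.eval_eq_sum]
  exact Finset.sum_le_sum fun i _ => Nat.mul_le_mul_left _ (Nat.pow_le_pow_left h i)

/-! ### Growth of the stacks -/

section Growth

variable {K : Type} [DecidableEq K] {Γ : K → Type} {Λ σ : Type}

/-- The number of `push` instructions in a statement. -/
def pushCount : TM2.Stmt Γ Λ σ → ℕ
  | .push _ _ q => pushCount q + 1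
  | .peek _ _ q => pushCount q
  | .pop _ _ q => pushCount q
  | .load _ q => pushCount q
  | .branch _ q r => pushCount q + pushCount r
  | .goto _ => 0
  | .halt => 0

theorem length_stepAux_le (q : TM2.Stmt Γ Λ σ) (v : σ) (s : ∀ k, List (Γ k)) (k : K) :
    ((TM2.stepAux q v s).stk k).length ≤ (s k).length + pushCount q := by
  induction q generalizing v s with
  | push k' f q ih =>
    refine (ih _ _).trans ?_
    by_cases h : k = k'
    · subst h; simp [pushCount]; omega
    · simp [h, pushCount]
  | peek k' f q ih => exact ih _ _
  | pop k' f q ih =>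
    refine (ih _ _).trans ?_
    by_cases h : k = k'
    · subst h; simp [pushCount]
    · simp [h, pushCount]
  | load a q ih => exact ih _ _
  | branch p q r ih1 ih2 =>
    simp only [TM2.stepAux, pushCount]
    cases p v
    · exact (ih2 _ _).trans (by omega)
    · exact (ih1 _ _).trans (by omega)
  | goto l => simp [pushCount]
  | halt => simp [pushCount]

/-- One step executes one statement, which lengthens a stack by at most `C` letters. -/
theorem length_le_of_stepsTo {M : Λ → TM2.Stmt Γ Λ σ} {C : ℕ} (hC : ∀ l, pushCount (M l) ≤ C)
    {n : ℕ} {c c' : TM2.Cfg Γ Λ σ} (h : StepsTo (TM2.step M) n c c') (k : K) :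
    (c'.stk k).length ≤ (c.stk k).length + C * n := by
  induction h with
  | refl n c => omega
  | @head n a b c h1 _ ih =>
    rcases a with ⟨_ | l, v, s⟩
    · simp [TM2.step] at h1
    · simp only [TM2.step, Option.some.injEq] at h1
      subst h1
      have := length_stepAux_le (M l) v s k
      have := hC l
      have : C * (n + 1) = C * n + C := by ring
      simp only at *
      omega

end Growth

/-- The values of a polynomial-time computable function have polynomial length. -/
theorem output_length_le {α β αΓ βΓ : Type} {ea : α → List αΓ} {eb : β → List βΓ} {f : α → β}
    (h : PolyTimeComputable ea eb f) :
    ∃ p : Polynomial ℕ, ∀ x, (eb (f x)).length ≤ p.eval (ea x).length := by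
  obtain ⟨⟨⟨tm, inA, outA⟩, time, h⟩⟩ := h
  have := tm.ΛFin
  -- There are finitely many labels, so the sum of their push counts bounds the growth per step. The
  -- summand `X` covers the case that the output stack is also the input stack.
  refine ⟨Polynomial.X + Polynomial.C (∑ l, pushCount (tm.m l)) * time, fun x => ?_⟩
  have h1 := length_le_of_stepsTo (C := ∑ l, pushCount (tm.m l))
    (fun l => Finset.single_le_sum (f := fun l => pushCount (tm.m l)) (fun _ _ => Nat.zero_le _)
      (Finset.mem_univ l)) (stepsTo_of_outputs (h x)) tm.k₁
  have h2 : ((update (fun _ => []) tm.k₀ ((ea x).map inA.invFun) : ∀ k, List (tm.Γ k))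
      tm.k₁).length ≤ (ea x).length := by
    by_cases hk : tm.k₁ = tm.k₀
    · have key : ∀ k, k = tm.k₀ → ((update (fun _ => []) tm.k₀ ((ea x).map inA.invFun) :
          ∀ k, List (tm.Γ k)) k).length ≤ (ea x).length := by
        rintro k rfl; simp
      exact key _ hk
    · simp [hk]
  simp only [update_self, List.length_map] at h1
  simp only [Polynomial.eval_add, Polynomial.eval_X, Polynomial.eval_mul, Polynomial.eval_C]
  exact h1.trans (Nat.add_le_add_right h2 _)

/-! ### Subroutines -/

section Embed

variable {K K' : Type} [DecidableEq K] [DecidableEq K'] {Γ : K → Type} {Γ' : K' → Type}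
  {Λ Λ' σ σ' : Type}

/-- A statement of a machine as a statement of a larger machine that runs it as a subroutine. -/
def embed (e : K → K') (ι : ∀ k, Γ k ≃ Γ' (e k)) (get : σ' → σ) (put : σ' → σ → σ')
    (lab : Λ → Λ') (exit : Λ') : TM2.Stmt Γ Λ σ → TM2.Stmt Γ' Λ' σ'
  | .push k f q => .push (e k) (fun v => ι k (f (get v))) (embed e ι get put lab exit q)
  | .peek k f q => .peek (e k) (fun v o => put v (f (get v) (o.map (ι k).symm)))
      (embed e ι get put lab exit q)
  | .pop k f q => .pop (e k) (fun v o => put v (f (get v) (o.map (ι k).symm)))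
      (embed e ι get put lab exit q)
  | .load a q => .load (fun v => put v (a (get v))) (embed e ι get put lab exit q)
  | .branch p q r => .branch (fun v => p (get v)) (embed e ι get put lab exit q)
      (embed e ι get put lab exit r)
  | .goto l => .goto fun v => lab (l (get v))
  | .halt => .goto fun _ => exit

variable {e : K → K'} {ι : ∀ k, Γ k ≃ Γ' (e k)} {get : σ' → σ} {put : σ' → σ → σ'}
  {lab : Λ → Λ'} {exit : Λ'} {V : σ → σ'} {S : (∀ k, List (Γ k)) → ∀ k, List (Γ' k)}

/-- Here `S` and `V` place the stacks and the internal state of the small machine inside those of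
the large one. Both machines agree instruction by instruction; only halting, where the label is
`none`, becomes a jump to `exit`. -/
theorem stepAux_embed (hget : ∀ v, get (V v) = v) (hput : ∀ v w, put (V v) w = V w)
    (hS : ∀ s k, S s (e k) = (s k).map (ι k))
    (hS' : ∀ s k l, update (S s) (e k) (l.map (ι k)) = S (update s k l))
    (q : TM2.Stmt Γ Λ σ) (v : σ) (s : ∀ k, List (Γ k)) :
    TM2.stepAux (embed e ι get put lab exit q) (V v) (S s) =
      ⟨some ((TM2.stepAux q v s).l.elim exit lab), V (TM2.stepAux q v s).var,
        S (TM2.stepAux q v s).stk⟩ := by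
  induction q generalizing v s with
  | push k f q ih =>
    simp only [embed, TM2.stepAux, hget]
    rw [hS, ← List.map_cons, hS', ih]
  | peek k f q ih =>
    simp only [embed, TM2.stepAux, hget, hput]
    rw [hS, List.head?_map, Option.map_map]
    simp only [Equiv.symm_comp_self, Option.map_id, id]
    exact ih _ _
  | pop k f q ih =>
    simp only [embed, TM2.stepAux, hget, hput]
    rw [hS, List.head?_map, Option.map_map, ← List.map_tail, hS']
    simp only [Equiv.symm_comp_self, Option.map_id, id]
    exact ih _ _
  | load a q ih => simp only [embed, TM2.stepAux, hget, hput]; exact ih _ _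
  | branch p q r ih1 ih2 =>
    simp only [embed, TM2.stepAux, hget]
    cases p v
    · exact ih2 _ _
    · exact ih1 _ _
  | goto l => simp [embed, hget]
  | halt => simp [embed]

/-- A larger machine runs a machine that is embedded in it. -/
theorem stepsTo_embed {M : Λ → TM2.Stmt Γ Λ σ} {M' : Λ' → TM2.Stmt Γ' Λ' σ'}
    (hM : ∀ l, M' (lab l) = embed e ι get put lab exit (M l))
    (hget : ∀ v, get (V v) = v) (hput : ∀ v w, put (V v) w = V w)
    (hS : ∀ s k, S s (e k) = (s k).map (ι k))
    (hS' : ∀ s k l, update (S s) (e k) (l.map (ι k)) = S (update s k l))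
    {n : ℕ} {c c' : TM2.Cfg Γ Λ σ} (h : StepsTo (TM2.step M) n c c') :
    StepsTo (TM2.step M') n ⟨some (c.l.elim exit lab), V c.var, S c.stk⟩
      ⟨some (c'.l.elim exit lab), V c'.var, S c'.stk⟩ := by
  induction h with
  | refl n c => exact .refl _ _
  | @head n a b c h1 _ ih =>
    rcases a with ⟨_ | l, v, s⟩
    · simp [TM2.step] at h1
    · simp only [TM2.step, Option.some.injEq] at h1
      subst h1
      refine .head ?_ ih
      simp only [Option.elim_some, TM2.step, Option.some.injEq]
      rw [hM, stepAux_embed hget hput hS hS']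

end Embed

/-! ### Loops that empty a stack -/

section Drain

variable {K : Type} [DecidableEq K] {Γ : K → Type} {Λ σ : Type}

/-- A loop that pops the letters of a stack one by one and treats each of them. In `F l d`, the list
`l` is what remains on the stack and `d` is what has been taken from it. -/
theorem stepsTo_drain {M : Λ → TM2.Stmt Γ Λ σ} {k : K} {L L' : Λ} {put : Γ k → Λ}
    {S : Option (Γ k) → σ} {next : σ → Λ} (F : List (Γ k) → List (Γ k) → ∀ k, List (Γ k))
    (hL : M L = .pop k (fun _ => S) (.goto next)) (hnext : ∀ a, next (S (some a)) = put a)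
    (hnone : next (S none) = L') (hF : ∀ l d, F l d k = l)
    (hput : ∀ a l d, TM2.stepAux (M (put a)) (S (some a)) (update (F (a :: l) d) k l) =
      ⟨some L, S (some a), F l (a :: d)⟩) (l d : List (Γ k)) (v : σ) :
    StepsTo (TM2.step M) (2 * l.length + 1) ⟨some L, v, F l d⟩
      ⟨some L', S none, F [] (l.reverse ++ d)⟩ := by
  induction l generalizing d v with
  | nil =>
    refine StepsTo.single ?_
    simp only [TM2.step, hL, TM2.stepAux, hF, List.head?_nil, List.tail_nil, hnone,
      List.reverse_nil, List.nil_append]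
    congr 2
    rw [update_eq_self_iff, hF]
  | cons a l ih =>
    have h1 : TM2.step M ⟨some L, v, F (a :: l) d⟩ =
        some ⟨some (put a), S (some a), update (F (a :: l) d) k l⟩ := by
      simp only [TM2.step, hL, TM2.stepAux, hF, List.head?_cons, List.tail_cons, hnext]
    have h2 : TM2.step M ⟨some (put a), S (some a), update (F (a :: l) d) k l⟩ =
        some ⟨some L, S (some a), F l (a :: d)⟩ := by
      rw [TM2.step, hput]
    have := StepsTo.head h1 (.head h2 (ih (a :: d) (S (some a))))
    simp only [List.reverse_cons, List.append_assoc, List.singleton_append]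
    refine this.mono ?_
    simp only [List.length_cons]; omega

end Drain

/-- The alphabets of two machines side by side. -/
abbrev SumAlphabet {K J : Type} (Γ : K → Type) (Δ : J → Type) : K ⊕ J → Type
  | .inl k => Γ k
  | .inr j => Δ j

/-- The stacks of two machines side by side. -/
def sumStk {K J : Type} {Γ : K → Type} {Δ : J → Type} (s : ∀ k, List (Γ k)) (t : ∀ j, List (Δ j)) :
    ∀ k : K ⊕ J, List (SumAlphabet Γ Δ k)
  | .inl k => s k
  | .inr j => t j

section sumStk

variable {K J : Type} {Γ : K → Type} {Δ : J → Type} (s : ∀ k, List (Γ k)) (t : ∀ j, List (Δ j))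

@[simp]
theorem sumStk_inl (k : K) : sumStk s t (.inl k) = s k := rfl

@[simp]
theorem sumStk_inr (j : J) : sumStk s t (.inr j) = t j := rfl

theorem sumStk_nil :
    (sumStk (fun _ => []) (fun _ => []) : ∀ k, List (SumAlphabet Γ Δ k)) = fun _ => [] := by
  funext k; rcases k with k | k <;> rfl

variable [DecidableEq K] [DecidableEq J]

@[simp]
theorem update_sumStk_inl (k : K) (l : List (Γ k)) :
    update (sumStk s t) (.inl k) l = sumStk (update s k l) t := by
  funext k'
  rcases k' with k' | j
  · by_cases h : k' = k
    · subst h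
      exact (update_self _ _ _).trans (update_self k' l s).symm
    · have h1 : update s k l k' = s k' := update_of_ne h _ _
      exact (update_of_ne (by simpa using h) _ _).trans h1.symm
  · exact update_of_ne (by simp) _ _

@[simp]
theorem update_sumStk_inr (j : J) (l : List (Δ j)) :
    update (sumStk s t) (.inr j) l = sumStk s (update t j l) := by
  funext k'
  rcases k' with k | j'
  · exact update_of_ne (by simp) _ _
  · by_cases h : j' = j
    · subst h
      exact (update_self _ _ _).trans (update_self j' l t).symm
    · have h1 : update t j l j' = t j' := update_of_ne h _ _
      exact (update_of_ne (by simpa using h) _ _).trans h1.symm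

theorem update_nil_inl (k : K) (l : List (Γ k)) :
    update (fun _ => [] : ∀ k, List (SumAlphabet Γ Δ k)) (.inl k) l =
      sumStk (update (fun _ => []) k l) fun _ => [] := by
  rw [← sumStk_nil, update_sumStk_inl]

theorem update_nil_inr (j : J) (l : List (Δ j)) :
    update (fun _ => [] : ∀ k, List (SumAlphabet Γ Δ k)) (.inr j) l =
      sumStk (fun _ => []) (update (fun _ => []) j l) := by
  rw [← sumStk_nil, update_sumStk_inr]

variable {Λ Λ' σ σ' : Type} {get : σ' → σ} {put : σ' → σ → σ'} {lab : Λ → Λ'} {exit : Λ'}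
  {V : σ → σ'} {M : Λ → TM2.Stmt Γ Λ σ}

theorem stepsTo_embed_inl {M' : Λ' → TM2.Stmt (SumAlphabet Γ Δ) Λ' σ'} (t : ∀ j, List (Δ j))
    (hM : ∀ l, M' (lab l) = embed (Γ' := SumAlphabet Γ Δ) Sum.inl (fun _ => Equiv.refl _) get put
      lab exit (M l))
    (hget : ∀ v, get (V v) = v) (hput : ∀ v w, put (V v) w = V w) {n : ℕ} {l : Λ} {v v' : σ}
    {s s' : ∀ k, List (Γ k)} (h : StepsTo (TM2.step M) n ⟨some l, v, s⟩ ⟨none, v', s'⟩) :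
    StepsTo (TM2.step M') n ⟨some (lab l), V v, sumStk s t⟩ ⟨some exit, V v', sumStk s' t⟩ :=
  stepsTo_embed (S := fun s => sumStk s t) hM hget hput (fun _ _ => (List.map_id _).symm)
    (fun s k l => by simp) h

theorem stepsTo_embed_inr_inl {I : Type} [DecidableEq I] {Θ : I → Type}
    {M' : Λ' → TM2.Stmt (SumAlphabet Θ (SumAlphabet Γ Δ)) Λ' σ'} (r : ∀ i, List (Θ i))
    (t : ∀ j, List (Δ j))
    (hM : ∀ l, M' (lab l) = embed (Γ' := SumAlphabet Θ (SumAlphabet Γ Δ))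
      (fun k => Sum.inr (Sum.inl k)) (fun _ => Equiv.refl _) get put lab exit (M l))
    (hget : ∀ v, get (V v) = v) (hput : ∀ v w, put (V v) w = V w) {n : ℕ} {l : Λ} {v v' : σ}
    {s s' : ∀ k, List (Γ k)} (h : StepsTo (TM2.step M) n ⟨some l, v, s⟩ ⟨none, v', s'⟩) :
    StepsTo (TM2.step M') n ⟨some (lab l), V v, sumStk r (sumStk s t)⟩
      ⟨some exit, V v', sumStk r (sumStk s' t)⟩ :=
  stepsTo_embed (S := fun s => sumStk r (sumStk s t)) hM hget hput
    (fun _ _ => (List.map_id _).symm)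
    (fun s k l => by simp) h

end sumStk

end PolyTime

/-! ### Finite-state transducers and compositions -/

namespace PolyTime

open Turing Function

theorem polyTimeComputable_of_stepsTo {α β αΓ βΓ : Type} {ea : α → List αΓ} {eb : β → List βΓ}
    {f : α → β} (tm : FinTM2) (inA : tm.Γ tm.k₀ ≃ αΓ) (outA : tm.Γ tm.k₁ ≃ βΓ)
    (time : Polynomial ℕ) (s s' : α → ∀ k, List (tm.Γ k))
    (hs : ∀ x, update (fun _ => []) tm.k₀ ((ea x).map inA.symm) = s x)
    (hs' : ∀ x, update (fun _ => []) tm.k₁ ((eb (f x)).map outA.symm) = s' x)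
    (h : ∀ x, StepsTo (TM2.step tm.m) (time.eval (ea x).length)
      ⟨some tm.main, tm.initialState, s x⟩ ⟨none, tm.initialState, s' x⟩) :
    PolyTimeComputable ea eb f :=
  ⟨⟨⟨tm, inA, outA⟩, time, fun x =>
    (outputs_of_stepsTo (by have := h x; rw [← hs, ← hs'] at this; exact this)).some⟩⟩

/-- The output of a transducer with transitions `δ` and final outputs `fin`, from the state `q`. -/
def transduce {Q A B : Type} (δ : Q → A → Q × List B) (fin : Q → List B) : Q → List A → List B
  | q, [] => fin q
  | q, a :: l => (δ q a).2 ++ transduce δ fin (δ q a).1 l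

section Transducer

variable {Q A B : Type}

theorem length_transduce_le {δ : Q → A → Q × List B} {fin : Q → List B} {C : ℕ}
    (hδ : ∀ q a, (δ q a).2.length ≤ C) (hfin : ∀ q, (fin q).length ≤ C) (q : Q) (l : List A) :
    (transduce δ fin q l).length ≤ C * (l.length + 1) := by
  induction l generalizing q with
  | nil => simpa [transduce] using hfin q
  | cons a l ih =>
    simp only [transduce, List.length_append, List.length_cons]
    have := ih (δ q a).1
    have := hδ q a
    have : C * (l.length + 1 + 1) = C * (l.length + 1) + C := by ring
    omega

/-- The stacks of a transducer. -/
inductive TransStack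
  | input
  | temp
  | output
  deriving DecidableEq

instance : Fintype TransStack :=
  ⟨{.input, .temp, .output}, fun k => by cases k <;> simp⟩

/-- The alphabets of the stacks of a transducer. -/
abbrev TransStack.Alphabet (A B : Type) : TransStack → Type
  | input => A
  | temp => B
  | output => B

/-- The labels of a transducer. -/
inductive TransLabel (Q A B : Type)
  | read (q : Q)
  | write (q : Q) (a : A)
  | halted (q : Q)
  | flip
  | flop (b : B)
  | done
  deriving Fintype

/-- Contents of the stacks of a transducer. -/
def TransStack.fill (i : List A) (t o : List B) : ∀ k, List (TransStack.Alphabet A B k)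
  | input => i
  | temp => t
  | output => o

/-- A statement that pushes the letters of a list one after the other. -/
def pushList {K : Type} {Γ : K → Type} {Λ σ : Type} (k : K) (l : List (Γ k))
    (q : TM2.Stmt Γ Λ σ) : TM2.Stmt Γ Λ σ :=
  l.foldr (fun b q => .push k (fun _ => b) q) q

theorem stepAux_pushList {K : Type} [DecidableEq K] {Γ : K → Type} {Λ σ : Type} (k : K)
    (l : List (Γ k)) (q : TM2.Stmt Γ Λ σ) (v : σ) (s : ∀ k, List (Γ k)) :
    TM2.stepAux (pushList k l q) v s = TM2.stepAux q v (update s k (l.reverse ++ s k)) := by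
  induction l generalizing s with
  | nil => simp [pushList]
  | cons b l ih =>
    have : pushList k (b :: l) q = .push k (fun _ => b) (pushList k l q) := rfl
    rw [this, TM2.stepAux, ih]
    simp

/-- The program of a transducer. -/
def transProgram (δ : Q → A → Q × List B) (fin : Q → List B) :
    TransLabel Q A B → TM2.Stmt (TransStack.Alphabet A B) (TransLabel Q A B)
      (Option (Q × A) × Option B)
  | .read q => .pop .input (fun _ o => (o.map (Prod.mk q), none))
      (.goto fun v => v.1.elim (.halted q) fun p => .write p.1 p.2)
  | .write q a => pushList .temp (δ q a).2 (.goto fun _ => .read (δ q a).1)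
  | .halted q => pushList .temp (fin q) (.goto fun _ => .flip)
  | .flip => .pop .temp (fun _ o => (none, o)) (.goto fun v => v.2.elim .done .flop)
  | .flop b => .push .output (fun _ => b) (.goto fun _ => .flip)
  | .done => .halt

/-- The output accumulates on `temp` with its last letter on top, hence the reversal; the loop of
`flip` and `flop` turns it around afterwards. -/
theorem transProgram_read (δ : Q → A → Q × List B) (fin : Q → List B) (l : List A) (t : List B)
    (q : Q) (v) :
    StepsTo (TM2.step (transProgram δ fin)) (2 * l.length + 2)
      ⟨some (.read q), v, TransStack.fill l t []⟩
      ⟨some .flip, (none, none), TransStack.fill [] ((transduce δ fin q l).reverse ++ t) []⟩ := by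
  induction l generalizing t q v with
  | nil =>
    refine .head (b := ⟨some (.halted q), (none, none), TransStack.fill [] t []⟩) ?_
      (.head ?_ (.refl 0 _))
    · simp only [transProgram, TM2.step, TM2.stepAux]
      congr 2
      funext k; cases k <;> rfl
    · simp only [transProgram, TM2.step, stepAux_pushList, TM2.stepAux]
      congr 2
      funext k; cases k <;> rfl
  | cons a l ih =>
    have hw := ih ((δ q a).2.reverse ++ t) (δ q a).1 (some (q, a), none)
    refine .head (b := ⟨some (.write q a), (some (q, a), none), TransStack.fill l t []⟩) ?_
      (.head (b := ⟨some (.read (δ q a).1), (some (q, a), none),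
        TransStack.fill l ((δ q a).2.reverse ++ t) []⟩) ?_ ?_)
    · simp only [transProgram, TM2.step, TM2.stepAux]
      congr 2
      funext k; cases k <;> rfl
    · simp only [transProgram, TM2.step, stepAux_pushList, TM2.stepAux]
      congr 2
      funext k; cases k <;> rfl
    · rw [transduce, List.reverse_append, List.append_assoc]
      exact hw.mono (by simp only [List.length_cons]; omega)

/-- Transducers run in polynomial time. -/
theorem polyTimeComputable_transduce [Fintype Q] [Fintype A] [Fintype B]
    (δ : Q → A → Q × List B) (fin : Q → List B) (q : Q) :
    PolyTimeComputable id id (transduce δ fin q) := by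
  classical
  let C : ℕ := (∑ q, ∑ a, (δ q a).2.length) + ∑ q, (fin q).length
  have hδ : ∀ q a, (δ q a).2.length ≤ C := fun q a =>
    ((Finset.single_le_sum (f := fun a => (δ q a).2.length) (fun _ _ => Nat.zero_le _)
      (Finset.mem_univ a)).trans (Finset.single_le_sum (f := fun q => ∑ a, (δ q a).2.length)
      (fun _ _ => Nat.zero_le _) (Finset.mem_univ q))).trans (Nat.le_add_right _ _)
  have hfin : ∀ q, (fin q).length ≤ C := fun q =>
    (Finset.single_le_sum (f := fun q => (fin q).length) (fun _ _ => Nat.zero_le _)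
      (Finset.mem_univ q)).trans (Nat.le_add_left _ _)
  let tm : FinTM2 :=
    { K := TransStack, k₀ := .input, k₁ := .output, Γ := TransStack.Alphabet A B
      Λ := TransLabel Q A B, main := .read q, σ := Option (Q × A) × Option B
      initialState := (none, none), Γk₀Fin := ‹Fintype A›, m := transProgram δ fin }
  -- Two steps per input letter and two more to finish reading; two steps per output letter and one
  -- more to turn the output around; one step to halt. The output has at most `C` letters per input
  -- letter and `C` at the end.
  refine polyTimeComputable_of_stepsTo tm (Equiv.refl A) (Equiv.refl B)
    (2 * Polynomial.X + 2 + (2 * (Polynomial.C C * (Polynomial.X + 1)) + 1 + 1))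
    (fun x => TransStack.fill x [] []) (fun x => TransStack.fill [] [] (transduce δ fin q x))
    (fun x => by funext k; cases k <;> simp [tm, TransStack.fill])
    (fun x => by funext k; cases k <;> simp [tm, TransStack.fill]) fun x => ?_
  have h1 := transProgram_read δ fin x [] q (none, none)
  have h2 := stepsTo_drain (M := transProgram δ fin) (k := .temp) (L := .flip) (L' := .done)
    (put := .flop) (S := fun o => (none, o))
    (next := fun v => v.2.elim .done .flop) (fun l d => TransStack.fill [] l d) rfl
    (fun _ => rfl) rfl (fun _ _ => rfl) (fun a l d => by
      simp only [transProgram, TM2.stepAux]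
      congr 1
      funext k; cases k <;> rfl) (transduce δ fin q x).reverse [] (none, none)
  rw [List.append_nil] at h1 h2
  rw [List.reverse_reverse] at h2
  have h3 : StepsTo (TM2.step (transProgram δ fin)) 1
      ⟨some .done, (none, none), TransStack.fill [] [] (transduce δ fin q x)⟩
      ⟨none, (none, none), TransStack.fill [] [] (transduce δ fin q x)⟩ := .single rfl
  refine (h1.trans (h2.trans h3)).mono ?_
  have := length_transduce_le hδ hfin q x
  simp only [Polynomial.eval_add, Polynomial.eval_mul, Polynomial.eval_X, Polynomial.eval_C,
    Polynomial.eval_ofNat, Polynomial.eval_one, List.length_reverse, id]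
  omega

end Transducer

section Comp

/-- The labels of the part of a composite machine that passes the result of the first machine on to
the second one. -/
inductive PassLabel (B : Type)
  | take
  | stash (b : B)
  | give
  | put (b : B)
  | done
  deriving Fintype

variable {B : Type}

/-- The alphabets of a machine composed of two machines with an intermediate stack. -/
abbrev CompAlphabet (tm tm' : FinTM2) (B : Type) : tm.K ⊕ (tm'.K ⊕ Unit) → Type :=
  SumAlphabet tm.Γ (SumAlphabet tm'.Γ fun _ => B)

/-- The stacks of a machine composed of two machines with an intermediate stack. -/
abbrev compStk {tm tm' : FinTM2} (s : ∀ k, List (tm.Γ k)) (s' : ∀ k, List (tm'.Γ k))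
    (l : List B) : ∀ k, List (CompAlphabet tm tm' B k) :=
  sumStk s (sumStk s' fun _ => l)

/-- The program of the composition of two machines. -/
def compProgram (tm tm' : FinTM2) (out : tm.Γ tm.k₁ ≃ B) (inp : tm'.Γ tm'.k₀ ≃ B) :
    tm.Λ ⊕ (tm'.Λ ⊕ PassLabel B) → TM2.Stmt (CompAlphabet tm tm' B)
      (tm.Λ ⊕ (tm'.Λ ⊕ PassLabel B)) (tm.σ × tm'.σ × Option B)
  | .inl l => embed (Γ' := CompAlphabet tm tm' B) Sum.inl (fun _ => Equiv.refl _) (fun v => v.1)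
      (fun v w => (w, v.2)) Sum.inl (.inr (.inr .take)) (tm.m l)
  | .inr (.inl l) => embed (Γ' := CompAlphabet tm tm' B) (fun k => Sum.inr (Sum.inl k))
      (fun _ => Equiv.refl _) (fun v => v.2.1) (fun v w => (v.1, w, v.2.2))
      (fun l => .inr (.inl l)) (.inr (.inr .done)) (tm'.m l)
  | .inr (.inr .take) => .pop (Sum.inl tm.k₁)
      (fun _ o => (tm.initialState, tm'.initialState, o.map out))
      (.goto fun v => .inr (.inr (v.2.2.elim .give .stash)))
  | .inr (.inr (.stash b)) => .push (.inr (.inr ())) (fun _ => b) (.goto fun _ => .inr (.inr .take))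
  | .inr (.inr .give) => .pop (.inr (.inr ()))
      (fun _ o => (tm.initialState, tm'.initialState, o))
      (.goto fun v => .inr (v.2.2.elim (.inl tm'.main) fun b => .inr (.put b)))
  | .inr (.inr (.put b)) => .push (.inr (.inl tm'.k₀)) (fun _ => inp.symm b)
      (.goto fun _ => .inr (.inr .give))
  | .inr (.inr .done) => .halt

theorem update_const_unit {B : Type} (l l' : List B) (u : Unit) :
    update (fun _ : Unit => l) u l' = fun _ => l' := by
  funext; simp

/-- Polynomial-time computable functions compose. -/
theorem PolyTimeComputable.comp {α β γ A C : Type} [Fintype B] {ea : α → List A}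
    {eb : β → List B} {ec : γ → List C} {g : β → γ} {f : α → β}
    (hg : PolyTimeComputable eb ec g) (hf : PolyTimeComputable ea eb f) :
    PolyTimeComputable ea ec fun x => g (f x) := by
  obtain ⟨p, hp⟩ := output_length_le hf
  obtain ⟨⟨⟨tm, inp, out⟩, time, h⟩⟩ := hf
  obtain ⟨⟨⟨tm', inp', out'⟩, time', h'⟩⟩ := hg
  have := tm.ΛFin
  have := tm'.ΛFin
  have := tm.σFin
  have := tm'.σFin
  have := tm.kFin
  have := tm'.kFin
  have := tm.Γk₀Fin
  let M := compProgram tm tm' out inp'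
  let comp : FinTM2 :=
    { K := tm.K ⊕ (tm'.K ⊕ Unit), k₀ := .inl tm.k₀, k₁ := .inr (.inl tm'.k₁)
      Γ := CompAlphabet tm tm' B, Λ := tm.Λ ⊕ (tm'.Λ ⊕ PassLabel B), main := .inl tm.main
      σ := tm.σ × tm'.σ × Option B, initialState := (tm.initialState, tm'.initialState, none)
      Γk₀Fin := tm.Γk₀Fin, m := M }
  -- The intermediate word is moved twice because each transfer reverses it. The second machine
  -- reads at most `p` letters, hence `time'.comp p`.
  refine polyTimeComputable_of_stepsTo comp inp out'
    (time + ((2 * p + 1) + ((2 * p + 1) + (time'.comp p + 1))))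
    (fun x => compStk (update (fun _ => []) tm.k₀ ((ea x).map inp.symm)) (fun _ => []) [])
    (fun x => compStk (fun _ => [])
      (update (fun _ => []) tm'.k₁ ((ec (g (f x))).map out'.symm)) [])
    (fun x => (update_nil_inl _ _).trans (congrArg (sumStk _) sumStk_nil.symm))
    (fun x => (update_nil_inr _ _).trans (congrArg (sumStk _) (update_nil_inl _ _))) fun x => ?_
  have h1 := stepsTo_embed_inl (M' := M) (sumStk (fun _ => []) fun _ => []) (fun _ => rfl)
    (get := fun v => v.1) (put := fun v w => (w, v.2)) (lab := Sum.inl)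
    (exit := .inr (.inr .take)) (V := fun v => (v, tm'.initialState, none)) (fun _ => rfl) (fun _ _ => rfl)
    (stepsTo_of_outputs (h x))
  have h2 := stepsTo_drain (M := M) (k := .inl tm.k₁) (L := .inr (.inr .take))
    (L' := .inr (.inr .give)) (put := fun b => .inr (.inr (.stash (out b))))
    (S := fun o => (tm.initialState, tm'.initialState, o.map out))
    (next := fun v => .inr (.inr (v.2.2.elim .give .stash)))
    (fun l d => compStk (update (fun _ => []) tm.k₁ l) (fun _ => []) (d.map out)) rfl
    (fun _ => rfl) rfl (fun _ _ => by simp) (fun a l d => by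
      simp [M, compProgram, update_const_unit]) (((eb (f x))).map out.symm) []
    (tm.initialState, tm'.initialState, none)
  have h3 := stepsTo_drain (M := M) (k := .inr (.inr ())) (L := .inr (.inr .give))
    (L' := .inr (.inl tm'.main)) (put := fun b => .inr (.inr (.put b)))
    (S := fun o => (tm.initialState, tm'.initialState, o))
    (next := fun v => .inr (v.2.2.elim (.inl tm'.main) fun b => .inr (.put b)))
    (fun l d => compStk (fun _ => []) (update (fun _ => []) tm'.k₀ (d.map inp'.symm)) l) rfl
    (fun _ => rfl) rfl (fun _ _ => by simp) (fun a l d => by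
      simp [M, compProgram, update_const_unit]) ((eb (f x)).reverse) []
    (tm.initialState, tm'.initialState, none)
  have h4 := stepsTo_embed_inr_inl (M' := M) (fun _ => []) (fun _ => []) (fun _ => rfl)
    (get := fun v => v.2.1) (put := fun v w => (v.1, w, v.2.2)) (lab := fun l => .inr (.inl l))
    (exit := .inr (.inr .done)) (V := fun v => (tm.initialState, v, none)) (fun _ => rfl) (fun _ _ => rfl)
    (stepsTo_of_outputs (h' (f x)))
  have h5 : StepsTo (TM2.step M) 1
      ⟨some (.inr (.inr .done)), (tm.initialState, tm'.initialState, none),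
        compStk (fun _ => []) (update (fun _ => []) tm'.k₁ ((ec (g (f x))).map out'.symm)) []⟩
      ⟨none, (tm.initialState, tm'.initialState, none),
        compStk (fun _ => []) (update (fun _ => []) tm'.k₁ ((ec (g (f x))).map out'.symm)) []⟩ :=
    .single rfl
  simp at h1 h2 h3 h4
  refine (h1.trans (h2.trans (h3.trans (h4.trans h5)))).mono ?_
  have := hp x
  have := eval_mono time' this
  simp
  omega

end Comp

end PolyTime

/-! ### Pairing and iteration -/

namespace PolyTime

open Turing Function

section Fork

variable {A B C : Type}

/-- The additional stacks of a machine that runs two machines on the same input. -/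
inductive ForkStack
  | input
  | temp
  | stash
  | output
  deriving DecidableEq

instance : Fintype ForkStack :=
  ⟨{.input, .temp, .stash, .output}, fun k => by cases k <;> simp⟩

/-- The alphabets of the additional stacks. -/
abbrev ForkStack.Alphabet (A B C : Type) : ForkStack → Type
  | input => A
  | temp => A
  | stash => B ⊕ C
  | output => B ⊕ C

/-- Contents of the additional stacks. -/
def ForkStack.fill (i t : List A) (s o : List (B ⊕ C)) : ∀ k, List (ForkStack.Alphabet A B C k)
  | input => i
  | temp => t
  | stash => s
  | output => o

namespace ForkStack

variable (i t l : List A) (s o r : List (B ⊕ C))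

@[simp]
theorem fill_input : fill i t s o .input = i := rfl

@[simp]
theorem fill_temp : fill i t s o .temp = t := rfl

@[simp]
theorem fill_stash : fill i t s o .stash = s := rfl

@[simp]
theorem fill_output : fill i t s o .output = o := rfl

@[simp]
theorem update_input : update (fill i t s o) .input l = fill l t s o := by
  funext k; cases k <;> rfl

@[simp]
theorem update_temp : update (fill i t s o) .temp l = fill i l s o := by
  funext k; cases k <;> rfl

@[simp]
theorem update_stash : update (fill i t s o) .stash r = fill i t r o := by
  funext k; cases k <;> rfl

@[simp]
theorem update_output : update (fill i t s o) .output r = fill i t s r := by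
  funext k; cases k <;> rfl

theorem fill_nil : (fun _ => [] : ∀ k, List (Alphabet A B C k)) = fill [] [] [] [] := by
  funext k; cases k <;> rfl

theorem update_nil_input :
    update (fun _ => [] : ∀ k, List (Alphabet A B C k)) .input l = fill l [] [] [] := by
  rw [fill_nil, update_input]

theorem update_nil_output :
    update (fun _ => [] : ∀ k, List (Alphabet A B C k)) .output r = fill [] [] [] r := by
  rw [fill_nil, update_output]

end ForkStack

/-- The labels of the part of the machine that copies the input and joins the outputs. -/
inductive ForkLabel (A B C : Type)
  | turn
  | turnPut (a : A)
  | copy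
  | copyPut (a : A)
  | left
  | leftPut (b : B)
  | right
  | rightPut (c : C)
  | join
  | joinPut (x : B ⊕ C)
  | done
  deriving Fintype

/-- The alphabets of a machine that runs two machines on the same input. -/
abbrev ForkAlphabet (tm tm' : FinTM2) (A B C : Type) : tm.K ⊕ (tm'.K ⊕ ForkStack) → Type :=
  SumAlphabet tm.Γ (SumAlphabet tm'.Γ (ForkStack.Alphabet A B C))

/-- The stacks of a machine that runs two machines on the same input. -/
abbrev forkStk {tm tm' : FinTM2} (s : ∀ k, List (tm.Γ k)) (s' : ∀ k, List (tm'.Γ k))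
    (i t : List A) (u o : List (B ⊕ C)) : ∀ k, List (ForkAlphabet tm tm' A B C k) :=
  sumStk s (sumStk s' (ForkStack.fill i t u o))

/-- The program that runs two machines on the same input. -/
def forkProgram (tm tm' : FinTM2) (inp : tm.Γ tm.k₀ ≃ A) (out : tm.Γ tm.k₁ ≃ B)
    (inp' : tm'.Γ tm'.k₀ ≃ A) (out' : tm'.Γ tm'.k₁ ≃ C) :
    tm.Λ ⊕ (tm'.Λ ⊕ ForkLabel A B C) → TM2.Stmt (ForkAlphabet tm tm' A B C)
      (tm.Λ ⊕ (tm'.Λ ⊕ ForkLabel A B C)) (tm.σ × tm'.σ × Option (A ⊕ (B ⊕ C)))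
  | .inl l => embed (Γ' := ForkAlphabet tm tm' A B C) Sum.inl (fun _ => Equiv.refl _)
      (fun v => v.1) (fun v w => (w, v.2)) Sum.inl (.inr (.inl tm'.main)) (tm.m l)
  | .inr (.inl l) => embed (Γ' := ForkAlphabet tm tm' A B C) (fun k => Sum.inr (Sum.inl k))
      (fun _ => Equiv.refl _) (fun v => v.2.1) (fun v w => (v.1, w, v.2.2))
      (fun l => .inr (.inl l)) (.inr (.inr .left)) (tm'.m l)
  | .inr (.inr .turn) => .pop (.inr (.inr .input))
      (fun _ o => (tm.initialState, tm'.initialState, o.map .inl))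
      (.goto fun v => .inr (.inr (v.2.2.elim .copy (Sum.elim .turnPut fun _ => .copy))))
  | .inr (.inr (.turnPut a)) => .push (.inr (.inr .temp)) (fun _ => a)
      (.goto fun _ => .inr (.inr .turn))
  | .inr (.inr .copy) => .pop (.inr (.inr .temp))
      (fun _ o => (tm.initialState, tm'.initialState, o.map .inl))
      (.goto fun v => v.2.2.elim (.inl tm.main)
        (Sum.elim (fun a => .inr (.inr (.copyPut a))) fun _ => .inl tm.main))
  | .inr (.inr (.copyPut a)) => .push (.inl tm.k₀) (fun _ => inp.symm a)
      (.push (.inr (.inl tm'.k₀)) (fun _ => inp'.symm a) (.goto fun _ => .inr (.inr .copy)))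
  | .inr (.inr .left) => .pop (.inl tm.k₁)
      (fun _ o => (tm.initialState, tm'.initialState, o.map fun b => .inr (.inl (out b))))
      (.goto fun v => .inr (.inr (v.2.2.elim .right
        (Sum.elim (fun _ => .right) (Sum.elim .leftPut fun _ => .right)))))
  | .inr (.inr (.leftPut b)) => .push (.inr (.inr .stash)) (fun _ => .inl b)
      (.goto fun _ => .inr (.inr .left))
  | .inr (.inr .right) => .pop (.inr (.inl tm'.k₁))
      (fun _ o => (tm.initialState, tm'.initialState, o.map fun b => .inr (.inr (out' b))))
      (.goto fun v => .inr (.inr (v.2.2.elim .join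
        (Sum.elim (fun _ => .join) (Sum.elim (fun _ => .join) .rightPut)))))
  | .inr (.inr (.rightPut c)) => .push (.inr (.inr .stash)) (fun _ => .inr c)
      (.goto fun _ => .inr (.inr .right))
  | .inr (.inr .join) => .pop (.inr (.inr .stash))
      (fun _ o => (tm.initialState, tm'.initialState, o.map .inr))
      (.goto fun v => .inr (.inr (v.2.2.elim .done (Sum.elim (fun _ => .done) .joinPut))))
  | .inr (.inr (.joinPut x)) => .push (.inr (.inr .output)) (fun _ => x)
      (.goto fun _ => .inr (.inr .join))
  | .inr (.inr .done) => .halt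

/-- Two polynomial-time computable functions can be computed on the same input. -/
theorem PolyTimeComputable.fork {α β γ : Type} [Fintype A] [Fintype B] [Fintype C]
    {ea : α → List A} {eb : β → List B} {ec : γ → List C} {f : α → β} {g : α → γ}
    (hf : PolyTimeComputable ea eb f) (hg : PolyTimeComputable ea ec g) :
    PolyTimeComputable ea (fun p : β × γ => (eb p.1).map Sum.inl ++ (ec p.2).map Sum.inr)
      fun x => (f x, g x) := by
  obtain ⟨p, hp⟩ := output_length_le hf
  obtain ⟨p', hp'⟩ := output_length_le hg
  obtain ⟨⟨⟨tm, inp, out⟩, time, h⟩⟩ := hf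
  obtain ⟨⟨⟨tm', inp', out'⟩, time', h'⟩⟩ := hg
  have := tm.ΛFin
  have := tm'.ΛFin
  have := tm.σFin
  have := tm'.σFin
  have := tm.kFin
  have := tm'.kFin
  let M := forkProgram tm tm' inp out inp' out'
  let fork : FinTM2 :=
    { K := tm.K ⊕ (tm'.K ⊕ ForkStack), k₀ := .inr (.inr .input), k₁ := .inr (.inr .output)
      Γ := ForkAlphabet tm tm' A B C, Λ := tm.Λ ⊕ (tm'.Λ ⊕ ForkLabel A B C)
      main := .inr (.inr .turn), σ := tm.σ × tm'.σ × Option (A ⊕ (B ⊕ C))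
      initialState := (tm.initialState, tm'.initialState, none)
      Γk₀Fin := ‹Fintype A›, m := M }
  refine polyTimeComputable_of_stepsTo fork (Equiv.refl A) (Equiv.refl (B ⊕ C))
    ((2 * .X + 1) + ((2 * .X + 1) + (time + (time' + ((2 * p + 1) + ((2 * p' + 1) +
      ((2 * (p + p') + 1) + 1)))))))
    (fun x => forkStk (fun _ => []) (fun _ => []) (ea x) [] [] [])
    (fun x => forkStk (fun _ => []) (fun _ => []) [] [] []
      ((eb (f x)).map Sum.inl ++ (ec (g x)).map Sum.inr))
    (fun x => (update_nil_inr _ _).trans (congrArg (sumStk _) ((update_nil_inr _ _).trans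
      (congrArg (sumStk _) ((ForkStack.update_nil_input _).trans
        (congrArg (ForkStack.fill · [] [] []) (List.map_id _)))))))
    (fun x => (update_nil_inr _ _).trans (congrArg (sumStk _) ((update_nil_inr _ _).trans
      (congrArg (sumStk _) ((ForkStack.update_nil_output _).trans
        (congrArg (ForkStack.fill [] [] []) (List.map_id _))))))) fun x => ?_
  have h1 := stepsTo_drain (M := M) (k := .inr (.inr .input)) (L := .inr (.inr .turn))
    (L' := .inr (.inr .copy)) (put := fun a => .inr (.inr (.turnPut a)))
    (fun l d => forkStk (fun _ => []) (fun _ => []) l d [] []) rfl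
    (fun _ => rfl) rfl (fun _ _ => by simp) (fun a l d => by
      simp [M, forkProgram]) (ea x) [] (tm.initialState, tm'.initialState, none)
  have h2 := stepsTo_drain (M := M) (k := .inr (.inr .temp)) (L := .inr (.inr .copy))
    (L' := .inl tm.main) (put := fun a => .inr (.inr (.copyPut a)))
    (fun l d => forkStk (update (fun _ => []) tm.k₀ (d.map inp.symm))
      (update (fun _ => []) tm'.k₀ (d.map inp'.symm)) [] l [] []) rfl
    (fun _ => rfl) rfl (fun _ _ => by simp) (fun a l d => by
      simp [M, forkProgram]) (ea x).reverse [] (tm.initialState, tm'.initialState, none)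
  have h3 := stepsTo_embed_inl (M' := M)
    (sumStk (update (fun _ => []) tm'.k₀ ((ea x).map inp'.symm)) (ForkStack.fill [] [] [] []))
    (get := fun v => v.1) (put := fun v w => (w, v.2)) (lab := Sum.inl)
    (exit := .inr (.inl tm'.main)) (fun _ => rfl)
    (V := fun v => (v, tm'.initialState, none)) (fun _ => rfl) (fun _ _ => rfl)
    (stepsTo_of_outputs (h x))
  have h4 := stepsTo_embed_inr_inl (M' := M) (update (fun _ => []) tm.k₁ ((eb (f x)).map out.symm))
    (ForkStack.fill [] [] [] [])
    (get := fun v => v.2.1) (put := fun v w => (v.1, w, v.2.2)) (lab := fun l => .inr (.inl l))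
    (exit := .inr (.inr .left)) (fun _ => rfl) (V := fun v => (tm.initialState, v, none))
    (fun _ => rfl) (fun _ _ => rfl) (stepsTo_of_outputs (h' x))
  have h5 := stepsTo_drain (M := M) (k := .inl tm.k₁) (L := .inr (.inr .left))
    (L' := .inr (.inr .right)) (put := fun b => .inr (.inr (.leftPut (out b))))
    (fun l d => forkStk (update (fun _ => []) tm.k₁ l)
      (update (fun _ => []) tm'.k₁ ((ec (g x)).map out'.symm)) [] []
      (d.map fun b => .inl (out b)) []) rfl
    (fun _ => rfl) rfl (fun _ _ => by simp) (fun a l d => by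
      simp [M, forkProgram]) ((eb (f x)).map out.symm) [] (tm.initialState, tm'.initialState, none)
  have h6 := stepsTo_drain (M := M) (k := .inr (.inl tm'.k₁)) (L := .inr (.inr .right))
    (L' := .inr (.inr .join)) (put := fun b => .inr (.inr (.rightPut (out' b))))
    (fun l d => forkStk (fun _ => []) (update (fun _ => []) tm'.k₁ l) [] []
      ((d.map fun b => .inr (out' b)) ++ ((eb (f x)).map Sum.inl).reverse) []) rfl
    (fun _ => rfl) rfl (fun _ _ => by simp) (fun a l d => by
      simp [M, forkProgram]) ((ec (g x)).map out'.symm) [] (tm.initialState, tm'.initialState, none)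
  -- Both results were stashed one after the other in reversed order, so one more transfer yields
  -- them in the right order.
  have h7 := stepsTo_drain (M := M) (k := .inr (.inr .stash)) (L := .inr (.inr .join))
    (L' := .inr (.inr .done)) (put := fun b => .inr (.inr (.joinPut b)))
    (fun l d => forkStk (fun _ => []) (fun _ => []) [] [] l d) rfl
    (fun _ => rfl) rfl (fun _ _ => by simp) (fun a l d => by
      simp [M, forkProgram]) ((eb (f x)).map Sum.inl ++ (ec (g x)).map Sum.inr).reverse []
      (tm.initialState, tm'.initialState, none)
  have h8 : StepsTo (TM2.step M) 1 ⟨some (.inr (.inr .done)),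
        (tm.initialState, tm'.initialState, none), forkStk (fun _ => []) (fun _ => []) [] [] []
        ((eb (f x)).map Sum.inl ++ (ec (g x)).map Sum.inr)⟩
      ⟨none, (tm.initialState, tm'.initialState, none), forkStk (fun _ => []) (fun _ => []) [] [] []
        ((eb (f x)).map Sum.inl ++ (ec (g x)).map Sum.inr)⟩ := .single rfl
  simp [Function.comp_def] at h1 h2 h3 h4 h5 h6 h7
  refine (h1.trans (h2.trans (h3.trans (h4.trans (h5.trans (h6.trans (h7.trans h8))))))).mono ?_
  have := hp x
  have := hp' x
  simp
  omega

end Fork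

end PolyTime

/-! ### Iteration of a machine over a list -/

namespace PolyTime

open Turing Function

section Fold

variable {A S : Type}

/-- The additional stacks of a machine that iterates a machine over a list. -/
inductive FoldStack
  | input
  | list
  | temp
  | output
  deriving DecidableEq

instance : Fintype FoldStack :=
  ⟨{.input, .list, .temp, .output}, fun k => by cases k <;> simp⟩

/-- The alphabets of the additional stacks. -/
abbrev FoldStack.Alphabet (A S : Type) : FoldStack → Type
  | input => A ⊕ S
  | list => A
  | temp => S
  | output => S

/-- Contents of the additional stacks. -/
def FoldStack.fill (i : List (A ⊕ S)) (l : List A) (t o : List S) :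
    ∀ k, List (FoldStack.Alphabet A S k)
  | input => i
  | list => l
  | temp => t
  | output => o

namespace FoldStack

variable (i i' : List (A ⊕ S)) (l l' : List A) (t o t' : List S)

@[simp]
theorem fill_input : fill i l t o .input = i := rfl

@[simp]
theorem fill_list : fill i l t o .list = l := rfl

@[simp]
theorem fill_temp : fill i l t o .temp = t := rfl

@[simp]
theorem fill_output : fill i l t o .output = o := rfl

@[simp]
theorem update_input : update (fill i l t o) .input i' = fill i' l t o := by
  funext k; cases k <;> rfl

@[simp]
theorem update_list : update (fill i l t o) .list l' = fill i l' t o := by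
  funext k; cases k <;> rfl

@[simp]
theorem update_temp : update (fill i l t o) .temp t' = fill i l t' o := by
  funext k; cases k <;> rfl

@[simp]
theorem update_output : update (fill i l t o) .output t' = fill i l t t' := by
  funext k; cases k <;> rfl

theorem fill_nil : (fun _ => [] : ∀ k, List (Alphabet A S k)) = fill [] [] [] [] := by
  funext k; cases k <;> rfl

theorem update_nil_input :
    update (fun _ => [] : ∀ k, List (Alphabet A S k)) .input i = fill i [] [] [] := by
  rw [fill_nil, update_input]

theorem update_nil_output :
    update (fun _ => [] : ∀ k, List (Alphabet A S k)) .output o = fill [] [] [] o := by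
  rw [fill_nil, update_output]

end FoldStack

/-- The labels of the part of the machine that controls the iteration. -/
inductive FoldLabel (A S : Type)
  | read
  | readPut (x : A ⊕ S)
  | next
  | feed (a : A)
  | feedPut (a : A) (s : S)
  | start (a : A)
  | collect
  | collectPut (s : S)
  | finish
  | finishPut (s : S)
  | done
  deriving Fintype

/-- The alphabets of a machine that iterates a machine over a list. -/
abbrev FoldAlphabet (tm : FinTM2) (A S : Type) : tm.K ⊕ FoldStack → Type :=
  SumAlphabet tm.Γ (FoldStack.Alphabet A S)

/-- The stacks of a machine that iterates a machine over a list. -/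
abbrev foldStk {tm : FinTM2} (s : ∀ k, List (tm.Γ k)) (i : List (A ⊕ S)) (l : List A)
    (t o : List S) : ∀ k, List (FoldAlphabet tm A S k) :=
  sumStk s (FoldStack.fill i l t o)

/-- The program that iterates a machine over a list, from its last letter to its first. -/
def foldProgram (tm : FinTM2) (inp : tm.Γ tm.k₀ ≃ A ⊕ S) (out : tm.Γ tm.k₁ ≃ S) :
    tm.Λ ⊕ FoldLabel A S → TM2.Stmt (FoldAlphabet tm A S) (tm.Λ ⊕ FoldLabel A S)
      (tm.σ × Option (A ⊕ S))
  | .inl l => embed (Γ' := FoldAlphabet tm A S) Sum.inl (fun _ => Equiv.refl _)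
      (fun v => v.1) (fun v w => (w, v.2)) Sum.inl (.inr .collect) (tm.m l)
  | .inr .read => .pop (.inr .input) (fun _ o => (tm.initialState, o))
      (.goto fun v => .inr (v.2.elim .next .readPut))
  | .inr (.readPut (.inl a)) => .push (.inr .list) (fun _ => a) (.goto fun _ => .inr .read)
  | .inr (.readPut (.inr s)) => .push (.inr .temp) (fun _ => s) (.goto fun _ => .inr .read)
  | .inr .next => .pop (.inr .list) (fun _ o => (tm.initialState, o.map .inl))
      (.goto fun v => .inr (v.2.elim .finish (Sum.elim .feed fun _ => .finish)))
  | .inr (.feed a) => .pop (.inr .temp) (fun _ o => (tm.initialState, o.map .inr))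
      (.goto fun v => .inr (v.2.elim (.start a) (Sum.elim (fun _ => .start a) (.feedPut a))))
  | .inr (.feedPut a s) => .push (.inl tm.k₀) (fun _ => inp.symm (.inr s))
      (.goto fun _ => .inr (.feed a))
  | .inr (.start a) => .push (.inl tm.k₀) (fun _ => inp.symm (.inl a)) (.goto fun _ => .inl tm.main)
  | .inr .collect => .pop (.inl tm.k₁) (fun _ o => (tm.initialState, o.map fun s => .inr (out s)))
      (.goto fun v => .inr (v.2.elim .next (Sum.elim (fun _ => .next) .collectPut)))
  | .inr (.collectPut s) => .push (.inr .temp) (fun _ => s) (.goto fun _ => .inr .collect)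
  | .inr .finish => .pop (.inr .temp) (fun _ o => (tm.initialState, o.map .inr))
      (.goto fun v => .inr (v.2.elim .done (Sum.elim (fun _ => .done) .finishPut)))
  | .inr (.finishPut s) => .push (.inr .output) (fun _ => s) (.goto fun _ => .inr .finish)
  | .inr .done => .halt

variable {D : Type} {eS : D → List S} {step : A × D → D}

/-- The current value lies reversed on `temp`. Feeding it to the embedded machine restores its
order, and collecting the result reverses it again, so the invariant persists. The time consists of
two transfers of at most `2 * B + 1` steps, the run of the machine, and two single steps. -/
theorem foldProgram_round (tm : FinTM2) (inp : tm.Γ tm.k₀ ≃ A ⊕ S) (out : tm.Γ tm.k₁ ≃ S)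
    {a : A} {d : D} {B T : ℕ} (hd : (eS d).length ≤ B) (hd' : (eS (step (a, d))).length ≤ B)
    (h : TM2OutputsInTime tm ((Sum.inl a :: (eS d).map Sum.inr).map inp.symm)
      (some ((eS (step (a, d))).map out.symm)) T) (l : List A) (v : tm.σ × Option (A ⊕ S)) :
    StepsTo (TM2.step (foldProgram tm inp out)) (4 * B + T + 4)
      ⟨some (.inr .next), v, foldStk (fun _ => []) [] (a :: l) (eS d).reverse []⟩
      ⟨some (.inr .next), (tm.initialState, none),
        foldStk (fun _ => []) [] l (eS (step (a, d))).reverse []⟩ := by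
  have h1 : StepsTo (TM2.step (foldProgram tm inp out)) 1
      ⟨some (.inr .next), v, foldStk (fun _ => []) [] (a :: l) (eS d).reverse []⟩
      ⟨some (.inr (.feed a)), (tm.initialState, some (.inl a)),
        foldStk (fun _ => []) [] l (eS d).reverse []⟩ := .single (by
    simp [foldProgram])
  have h2 := stepsTo_drain (M := foldProgram tm inp out) (k := .inr .temp) (L := .inr (.feed a))
    (L' := .inr (.start a)) (put := fun s => .inr (.feedPut a s))
    (fun t d => foldStk (update (fun _ => []) tm.k₀ (d.map fun s => inp.symm (.inr s))) [] l t [])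
    rfl (fun _ => rfl) rfl (fun _ _ => by simp) (fun a l d => by simp [foldProgram])
    (eS d).reverse [] (tm.initialState, some (.inl a))
  have h3 : StepsTo (TM2.step (foldProgram tm inp out)) 1
      ⟨some (.inr (.start a)), (tm.initialState, none), foldStk (update (fun _ => []) tm.k₀
        ((eS d).map fun s => inp.symm (.inr s))) [] l [] []⟩
      ⟨some (.inl tm.main), (tm.initialState, none), foldStk (update (fun _ => []) tm.k₀
        ((Sum.inl a :: (eS d).map Sum.inr).map inp.symm)) [] l [] []⟩ := .single (by
    simp [foldProgram, Function.comp_def])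
  have h4 := stepsTo_embed_inl (M' := foldProgram tm inp out) (FoldStack.fill [] l [] [])
    (get := fun v => v.1) (put := fun v w => (w, v.2)) (lab := Sum.inl)
    (exit := .inr .collect) (fun _ => rfl) (V := fun v => (v, none)) (fun _ => rfl)
    (fun _ _ => rfl) (stepsTo_of_outputs h)
  have h5 := stepsTo_drain (M := foldProgram tm inp out) (k := .inl tm.k₁) (L := .inr .collect)
    (L' := .inr .next) (put := fun s => .inr (.collectPut (out s)))
    (fun t d => foldStk (update (fun _ => []) tm.k₁ t) [] l (d.map out) [])
    rfl (fun _ => rfl) rfl (fun _ _ => by simp) (fun a l d => by simp [foldProgram])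
    ((eS (step (a, d))).map out.symm) [] (tm.initialState, none)
  simp only [List.append_nil, List.reverse_reverse, List.map_nil, update_eq_self, List.map_reverse,
    List.map_map, Function.comp_def, Equiv.apply_symm_apply, List.map_id', Option.map_none,
    List.length_reverse, List.length_map] at h2 h5
  refine (h1.trans (h2.trans (h3.trans (h4.trans h5)))).mono ?_
  omega

/-- The letters of `r` have been processed and those of `l` are waiting with the last one on top, so
each round moves the last letter of `l` to the front of `r`. Only values reached from suffixes of
the list occur, and only those need to be short. -/
theorem foldProgram_rounds (tm : FinTM2) (inp : tm.Γ tm.k₀ ≃ A ⊕ S) (out : tm.Γ tm.k₁ ≃ S)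
    {B T : ℕ} (d : D) (l r : List A)
    (hB : ∀ l', l' <:+ l ++ r → (eS (l'.foldr (fun a d => step (a, d)) d)).length ≤ B)
    (h : ∀ a d, (eS d).length ≤ B →
      Nonempty (TM2OutputsInTime tm ((Sum.inl a :: (eS d).map Sum.inr).map inp.symm)
      (some ((eS (step (a, d))).map out.symm)) T)) (v : tm.σ × Option (A ⊕ S)) :
    StepsTo (TM2.step (foldProgram tm inp out)) (l.length * (4 * B + T + 4) + 1)
      ⟨some (.inr .next), v, foldStk (fun _ => []) [] l.reverse
        (eS (r.foldr (fun a d => step (a, d)) d)).reverse []⟩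
      ⟨some (.inr .finish), (tm.initialState, none), foldStk (fun _ => []) [] []
        (eS ((l ++ r).foldr (fun a d => step (a, d)) d)).reverse []⟩ := by
  induction l using List.reverseRecOn generalizing r v with
  | nil => exact (StepsTo.single (by simp [foldProgram])).mono (by omega)
  | append_singleton l a ih =>
    rw [List.append_assoc] at hB ⊢
    have hr := hB r ⟨l ++ [a], by simp⟩
    have hr' := hB ([a] ++ r) ⟨l, rfl⟩
    have h1 := foldProgram_round tm inp out hr hr' (h a _ hr).some l.reverse v
    have h2 := ih ([a] ++ r) hB (tm.initialState, none)
    rw [List.reverse_append]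
    refine (h1.trans h2).mono ?_
    simp only [List.length_append, List.length_singleton]
    ring_nf; omega

/-- Iterating a polynomial-time computable function over a list takes polynomial time, if the
intermediate results have polynomial length. -/
theorem PolyTimeComputable.foldr {α : Type} [Fintype A] [Fintype S] (L : α → List A) (d : α → D)
    (hstep : PolyTimeComputable (fun p : A × D => Sum.inl p.1 :: (eS p.2).map Sum.inr) eS step)
    (p : Polynomial ℕ) (hp : ∀ x l, l <:+ L x → (eS (l.foldr (fun a d => step (a, d)) (d x))).length ≤
      p.eval ((L x).length + (eS (d x)).length)) :
    PolyTimeComputable (fun x => (L x).map Sum.inl ++ (eS (d x)).map Sum.inr) eS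
      fun x => (L x).foldr (fun a d => step (a, d)) (d x) := by
  obtain ⟨⟨⟨tm, inp, out⟩, time, h⟩⟩ := hstep
  have := tm.ΛFin
  have := tm.σFin
  have := tm.kFin
  let M := foldProgram tm inp out
  let fold : FinTM2 :=
    { K := tm.K ⊕ FoldStack, k₀ := .inr .input, k₁ := .inr .output
      Γ := FoldAlphabet tm A S, Λ := tm.Λ ⊕ FoldLabel A S
      main := .inr .read, σ := tm.σ × Option (A ⊕ S)
      initialState := (tm.initialState, none)
      Γk₀Fin := inferInstanceAs (Fintype (A ⊕ S)), m := M }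
  -- The embedded machine reads the current value and one letter, hence `p + 1`. The number of
  -- rounds is bounded by the length `X` of the whole input.
  refine polyTimeComputable_of_stepsTo fold (Equiv.refl (A ⊕ S)) (Equiv.refl S)
    ((2 * .X + 1) + ((.X * (4 * p + time.comp (p + 1) + 4) + 1) + ((2 * p + 1) + 1)))
    (fun x => foldStk (fun _ => []) ((L x).map Sum.inl ++ (eS (d x)).map Sum.inr) [] [] [])
    (fun x => foldStk (fun _ => []) [] [] [] (eS ((L x).foldr (fun a d => step (a, d)) (d x))))
    (fun x => (update_nil_inr _ _).trans (congrArg (sumStk _) ((FoldStack.update_nil_input _).trans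
      (congrArg (FoldStack.fill · [] [] []) (List.map_id _)))))
    (fun x => (update_nil_inr _ _).trans (congrArg (sumStk _) ((FoldStack.update_nil_output _).trans
      (congrArg (FoldStack.fill [] [] []) (List.map_id _))))) fun x => ?_
  set B := p.eval ((L x).length + (eS (d x)).length) with hB
  have h1 := stepsTo_drain (M := M) (k := .inr .input) (L := .inr .read)
    (L' := .inr .next) (put := fun a => .inr (.readPut a))
    (fun l d => foldStk (fun _ => []) l (d.filterMap Sum.getLeft?) (d.filterMap Sum.getRight?) [])
    rfl (fun _ => rfl) rfl (fun _ _ => by simp) (fun a l d => by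
      rcases a with a | a <;> simp [M, foldProgram] <;> rfl)
      ((L x).map Sum.inl ++ (eS (d x)).map Sum.inr) [] (tm.initialState, none)
  have h2 := foldProgram_rounds (eS := eS) (step := step) tm inp out (B := B)
    (T := time.eval (B + 1)) (d x) (L x) []
    (fun l hl => hp x l (by simpa using hl)) (fun a d hd => ⟨by
      have := h (a, d)
      exact { this with
        steps_le_m := this.steps_le_m.trans (eval_mono time (by simpa using hd)) }⟩)
    (tm.initialState, none)
  have h3 := stepsTo_drain (M := M) (k := .inr .temp) (L := .inr .finish)
    (L' := .inr .done) (put := fun a => .inr (.finishPut a))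
    (fun l d => foldStk (fun _ => []) [] [] l d)
    rfl (fun _ => rfl) rfl (fun _ _ => by simp) (fun a l d => by simp [M, foldProgram])
    (eS ((L x).foldr (fun a d => step (a, d)) (d x))).reverse [] (tm.initialState, none)
  have h4 : StepsTo (TM2.step M) 1 ⟨some (.inr .done), (tm.initialState, none),
      foldStk (fun _ => []) [] [] [] (eS ((L x).foldr (fun a d => step (a, d)) (d x)))⟩
      ⟨none, (tm.initialState, none),
      foldStk (fun _ => []) [] [] [] (eS ((L x).foldr (fun a d => step (a, d)) (d x)))⟩ :=
    .single rfl
  have e1 : ((L x).map (Sum.inl (β := S)) ++ (eS (d x)).map Sum.inr).filterMap Sum.getLeft? =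
      L x := by simp [List.filterMap_map, Function.comp_def]
  have e2 : ((L x).map (Sum.inl (β := S)) ++ (eS (d x)).map Sum.inr).filterMap Sum.getRight? =
      eS (d x) := by simp [List.filterMap_map, Function.comp_def]
  simp only [List.append_nil, List.reverse_reverse, List.filterMap_reverse, List.filterMap_nil, e1,
    e2, Option.map_none, List.length_reverse, List.length_map, List.length_append,
    List.foldr_nil] at h1 h2 h3
  refine (h1.trans (h2.trans (h3.trans h4))).mono ?_
  have := hp x (L x) List.suffix_rfl
  simp only [Polynomial.eval_add, Polynomial.eval_mul, Polynomial.eval_X, Polynomial.eval_ofNat,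
    Polynomial.eval_one, Polynomial.eval_comp, List.length_append, List.length_map]
  rw [← hB] at this ⊢
  have h5 : (L x).length * (4 * B + time.eval (B + 1) + 4) ≤
    ((L x).length + (eS (d x)).length) * (4 * B + time.eval (B + 1) + 4) :=
    Nat.mul_le_mul_right _ (Nat.le_add_right _ _)
  omega

end Fold

end PolyTime

/-! ### Polynomial-time computable words -/

set_option linter.unusedSectionVars false

namespace PolyTime

open Turing

/-- The word `F x` can be computed from the encoding of `x` in polynomial time. -/
def WordComputable {α A B : Type} (ea : α → List A) (F : α → List B) : Prop :=
  PolyTimeComputable ea id F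

/-- Only the encoded value enters the notion of computation. Replacing values by their words turns
closure properties into operations on lists. -/
theorem wordComputable_of_polyTimeComputable {α β A B : Type} {ea : α → List A} {eb : β → List B}
    {f : α → β} (h : PolyTimeComputable ea eb f) : WordComputable ea fun x => eb (f x) := by
  obtain ⟨⟨aux, time, h⟩⟩ := h
  exact ⟨⟨aux, time, h⟩⟩

/-- Pairs are encoded over the disjoint union of the alphabets. -/
def pairWord {B C : Type} (p : List B × List C) : List (B ⊕ C) :=
  p.1.map Sum.inl ++ p.2.map Sum.inr

theorem flatMap_nil {A B : Type} (l : List A) : (l.flatMap fun _ => ([] : List B)) = [] :=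
  List.flatMap_eq_nil_iff.2 fun _ _ => rfl

namespace WordComputable

variable {α β γ D A₀ A B C S : Type} [Fintype A₀] [Fintype A] [Fintype B] [Fintype C] [Fintype S]
  {ea : α → List A₀} {F : α → List A} {G : α → List B}

theorem polyTimeComputable {eb : β → List B} {f : α → β}
    (h : WordComputable ea fun x => eb (f x)) : PolyTimeComputable ea eb f := by
  obtain ⟨⟨aux, time, h⟩⟩ := h
  exact ⟨⟨aux, time, h⟩⟩

theorem apply {eb : β → List B} {ec : γ → List C} {g : β → γ} {f : α → β}
    (hg : PolyTimeComputable eb ec g) (hf : WordComputable ea fun x => eb (f x)) :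
    WordComputable ea fun x => ec (g (f x)) :=
  wordComputable_of_polyTimeComputable (PolyTimeComputable.comp hg hf.polyTimeComputable)

theorem self : WordComputable ea ea :=
  wordComputable_of_polyTimeComputable ⟨idComputableInPolyTime ea⟩

theorem transduce {Q : Type} [Fintype Q] (δ : Q → A → Q × List B) (fin : Q → List B) (q : Q)
    (hF : WordComputable ea F) : WordComputable ea fun x => PolyTime.transduce δ fin q (F x) :=
  apply (eb := id) (ec := id) (polyTimeComputable_transduce δ fin q) hF

/-- Letters are replaced by words. -/
theorem flatMap (f : A → List B) (hF : WordComputable ea F) :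
    WordComputable ea fun x => (F x).flatMap f := by
  have : ∀ l : List A, PolyTime.transduce (fun (_ : Unit) a => ((), f a)) (fun _ => []) () l =
      l.flatMap f := by
    intro l
    induction l with
    | nil => rfl
    | cons a l ih => simp only [PolyTime.transduce, ih, List.flatMap_cons]
  simpa only [this] using hF.transduce (fun (_ : Unit) a => ((), f a)) (fun _ => []) ()

theorem map (f : A → B) (hF : WordComputable ea F) : WordComputable ea fun x => (F x).map f := by
  simpa only [List.map_eq_flatMap] using hF.flatMap (fun a => [f a])

/-- A finite amount of information is processed in an arbitrary way. -/
theorem lookup (n : ℕ) (f : List A → List B) (hF : WordComputable ea F) :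
    WordComputable ea fun x => f ((F x).take n) := by
  have : Finite {l : List A // l.length ≤ n} := List.finite_length_le A n
  have := Fintype.ofFinite {l : List A // l.length ≤ n}
  -- The state collects the first `n` letters, and nothing is written before the end of the input.
  -- The state space is finite, so `f` may be arbitrary.
  let δ : {l : List A // l.length ≤ n} → A → {l : List A // l.length ≤ n} × List B := fun l a =>
    (⟨(l.1 ++ [a]).take n, by simp⟩, [])
  have key : ∀ (l : List A) (q : {l : List A // l.length ≤ n}),
      PolyTime.transduce δ (fun q => f q.1) q l = f ((q.1 ++ l).take n) := by
    intro l
    induction l with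
    | nil => intro q; simp [PolyTime.transduce, List.take_of_length_le q.2]
    | cons a l ih =>
      intro q
      simp only [PolyTime.transduce, ih, δ, List.nil_append]
      congr 1
      have : q.1 ++ a :: l = (q.1 ++ [a]) ++ l := by simp
      rw [this]
      generalize q.1 ++ [a] = r
      rw [List.take_append, List.take_append, List.take_take, min_self, List.length_take]
      congr 2
      omega
  simpa only [key, List.nil_append] using hF.transduce δ (fun q => f q.1) ⟨[], Nat.zero_le _⟩

theorem const (l : List B) : WordComputable ea fun _ => l :=
  lookup 0 (fun _ => l) self

theorem tail (hF : WordComputable ea F) : WordComputable ea fun x => (F x).tail := by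
  let δ : Bool → A → Bool × List A := fun q a => (true, if q then [a] else [])
  have key : ∀ l : List A, PolyTime.transduce δ (fun _ => []) true l = l := by
    intro l
    induction l with
    | nil => rfl
    | cons a l ih => simpa [PolyTime.transduce, δ] using ih
  have key' : ∀ l : List A, PolyTime.transduce δ (fun _ => []) false l = l.tail := by
    intro l
    cases l with
    | nil => rfl
    | cons a l => simpa [PolyTime.transduce, δ] using key l
  simpa only [key'] using hF.transduce δ (fun _ => []) false

theorem takeWhile (p : A → Bool) (hF : WordComputable ea F) :
    WordComputable ea fun x => (F x).takeWhile p := by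
  let δ : Bool → A → Bool × List A := fun q a => (q && p a, if q && p a then [a] else [])
  have key : ∀ l : List A, PolyTime.transduce δ (fun _ => []) false l = [] := by
    intro l
    induction l with
    | nil => rfl
    | cons a l ih => simpa [PolyTime.transduce, δ] using ih
  have key' : ∀ l : List A, PolyTime.transduce δ (fun _ => []) true l = l.takeWhile p := by
    intro l
    induction l with
    | nil => rfl
    | cons a l ih =>
      cases h : p a
      · simpa [PolyTime.transduce, δ, h] using key l
      · simpa [PolyTime.transduce, δ, h] using ih
  simpa only [key'] using hF.transduce δ (fun _ => []) true

theorem dropWhile (p : A → Bool) (hF : WordComputable ea F) :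
    WordComputable ea fun x => (F x).dropWhile p := by
  let δ : Bool → A → Bool × List A := fun q a => (q && p a, if q && p a then [] else [a])
  have key : ∀ l : List A, PolyTime.transduce δ (fun _ => []) false l = l := by
    intro l
    induction l with
    | nil => rfl
    | cons a l ih => simpa [PolyTime.transduce, δ] using ih
  have key' : ∀ l : List A, PolyTime.transduce δ (fun _ => []) true l = l.dropWhile p := by
    intro l
    induction l with
    | nil => rfl
    | cons a l ih =>
      cases h : p a
      · simpa [PolyTime.transduce, δ, h] using key l
      · simpa [PolyTime.transduce, δ, h] using ih
  simpa only [key'] using hF.transduce δ (fun _ => []) true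

theorem pair (hF : WordComputable ea F) (hG : WordComputable ea G) :
    WordComputable ea fun x => (F x).map Sum.inl ++ (G x).map Sum.inr :=
  wordComputable_of_polyTimeComputable
    (PolyTimeComputable.fork (eb := id) (ec := id) hF hG)

theorem append {G : α → List A} (hF : WordComputable ea F) (hG : WordComputable ea G) :
    WordComputable ea fun x => F x ++ G x := by
  simpa only [List.map_append, List.map_map, Sum.elim_comp_inl, Sum.elim_comp_inr, List.map_id]
    using (hF.pair hG).map (Sum.elim id id)

/-- A transducer reads the bit in front of the two tagged words, remembers it and copies only the
letters with the corresponding tag. -/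
theorem ite {b : α → Bool} {G : α → List A} (hb : WordComputable ea fun x => [b x])
    (hF : WordComputable ea F) (hG : WordComputable ea G) :
    WordComputable ea fun x => if b x then F x else G x := by
  let δ : Option Bool → Bool ⊕ (A ⊕ A) → Option Bool × List A := fun q a =>
    match q, a with
    | none, .inl b => (some b, [])
    | some true, .inr (.inl a) => (q, [a])
    | some false, .inr (.inr a) => (q, [a])
    | _, _ => (q, [])
  have h1 : ∀ l r : List A, PolyTime.transduce δ (fun _ => []) (some true)
      (((l.map Sum.inl) ++ r.map Sum.inr).map Sum.inr) = l := by
    intro l r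
    induction l with
    | nil =>
      induction r with
      | nil => rfl
      | cons a r ih => simpa [PolyTime.transduce, δ] using ih
    | cons a l ih => simpa [PolyTime.transduce, δ] using ih
  have h2 : ∀ l r : List A, PolyTime.transduce δ (fun _ => []) (some false)
      (((l.map Sum.inl) ++ r.map Sum.inr).map Sum.inr) = r := by
    intro l r
    induction l with
    | nil =>
      induction r with
      | nil => rfl
      | cons a r ih => simpa [PolyTime.transduce, δ] using ih
    | cons a l ih => simpa [PolyTime.transduce, δ] using ih
  have key : ∀ (b : Bool) (l r : List A), PolyTime.transduce δ (fun _ => []) none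
      ([b].map Sum.inl ++ ((l.map Sum.inl) ++ r.map Sum.inr).map Sum.inr) = if b then l else r := by
    intro b l r
    cases b
    · exact h2 l r
    · exact h1 l r
  simpa only [key] using (hb.pair (hF.pair hG)).transduce δ (fun _ => []) none

theorem foldr {L : α → List A} {d : α → D} {eS : D → List S} {step : A → D → D}
    (hL : WordComputable ea L) (hd : WordComputable ea fun x => eS (d x))
    (hstep : WordComputable (fun p : A × D => Sum.inl p.1 :: (eS p.2).map Sum.inr)
      fun p => eS (step p.1 p.2))
    (p : Polynomial ℕ) (hp : ∀ x l, l <:+ L x → (eS (l.foldr step (d x))).length ≤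
      p.eval ((L x).length + (eS (d x)).length)) :
    WordComputable ea fun x => eS ((L x).foldr step (d x)) :=
  apply (eb := fun x => (L x).map Sum.inl ++ (eS (d x)).map Sum.inr)
    (PolyTimeComputable.foldr (step := fun p => step p.1 p.2) L d hstep.polyTimeComputable p hp)
    (hL.pair hd)

theorem reverse (hF : WordComputable ea F) : WordComputable ea fun x => (F x).reverse := by
  have key : ∀ l r : List A, l.foldr (fun a d => d ++ [a]) r = r ++ l.reverse := by
    intro l r
    induction l with
    | nil => simp
    | cons a l ih => simp [ih]
  have hstep : WordComputable (fun p : A × List A => Sum.inl p.1 :: p.2.map Sum.inr)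
      fun p => p.2 ++ [p.1] := by
    have h : WordComputable (fun p : A × List A => Sum.inl p.1 :: p.2.map Sum.inr)
      fun p => Sum.inl p.1 :: p.2.map Sum.inr := self
    simpa [List.flatMap_map, flatMap_nil] using
      (h.flatMap (Sum.elim (fun _ => []) fun a => [a])).append
        (h.flatMap (Sum.elim (fun a => [a]) fun _ => []))
  have := foldr (eS := id) (step := fun a d => d ++ [a]) hF (const (B := A) []) hstep .X
    (fun x l hl => by simpa [key] using hl.length_le)
  simpa [key] using this

theorem foldl {L : α → List A} {d : α → D} {eS : D → List S} {step : A → D → D}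
    (hL : WordComputable ea L) (hd : WordComputable ea fun x => eS (d x))
    (hstep : WordComputable (fun p : A × D => Sum.inl p.1 :: (eS p.2).map Sum.inr)
      fun p => eS (step p.1 p.2))
    (p : Polynomial ℕ) (hp : ∀ x l, l <+: L x → (eS (l.foldl (fun d a => step a d) (d x))).length ≤
      p.eval ((L x).length + (eS (d x)).length)) :
    WordComputable ea fun x => eS ((L x).foldl (fun d a => step a d) (d x)) := by
  have := foldr hL.reverse hd hstep p fun x l hl => by
    have := hp x l.reverse (by simpa using hl.reverse)
    simpa using this
  simpa using this

/-- Iteration of a function that adds at most a fixed number of letters. -/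
theorem foldl_of_length_le {L : α → List A} {d : α → D} {eS : D → List S} {step : A → D → D}
    (hL : WordComputable ea L) (hd : WordComputable ea fun x => eS (d x))
    (hstep : WordComputable (fun p : A × D => Sum.inl p.1 :: (eS p.2).map Sum.inr)
      fun p => eS (step p.1 p.2)) (n : ℕ)
    (hn : ∀ a d, (eS (step a d)).length ≤ (eS d).length + n) :
    WordComputable ea fun x => eS ((L x).foldl (fun d a => step a d) (d x)) := by
  refine foldl hL hd hstep ((.C n + 1) * .X) fun x l hl => ?_
  have key : ∀ (l : List A) (d : D), (eS (l.foldl (fun d a => step a d) d)).length ≤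
      (eS d).length + n * l.length := by
    intro l
    induction l with
    | nil => simp
    | cons a l ih =>
      intro d
      refine (ih _).trans ?_
      have := hn a d
      simp only [List.length_cons]
      nlinarith
  refine (key l (d x)).trans ?_
  have := hl.length_le
  simp
  nlinarith

end WordComputable

end PolyTime

/-! ### Loops with a growing counter, and unary arithmetic -/

namespace PolyTime

open Turing

theorem length_pairWord {B C : Type} (p : List B × List C) :
    (pairWord p).length = p.1.length + p.2.length := by
  simp [pairWord]

/-- The concatenation of the words `T a z'` for the letters `a` of a list, where `z'` grows by `t`
from one letter to the next. -/
def emit {A B Z : Type} (T : A → List Z → List B) (t : List Z) : List Z → List A → List B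
  | _, [] => []
  | z, a :: l => T a z ++ emit T t (z ++ t) l

namespace WordComputable

variable {α β γ D A₀ A B C S Z : Type} [Fintype A₀] [Fintype A] [Fintype B] [Fintype C] [Fintype S]
  [Fintype Z] {ea : α → List A₀} {F : α → List A} {G : α → List B}

theorem pairWord_left {P : α → List A × List B} (h : WordComputable ea fun x => pairWord (P x)) :
    WordComputable ea fun x => (P x).1 := by
  simpa [pairWord, List.flatMap_map, flatMap_nil] using
    h.flatMap (Sum.elim (fun a => [a]) fun _ => [])

theorem pairWord_right {P : α → List A × List B} (h : WordComputable ea fun x => pairWord (P x)) :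
    WordComputable ea fun x => (P x).2 := by
  simpa [pairWord, List.flatMap_map, flatMap_nil] using
    h.flatMap (Sum.elim (fun _ => []) fun a => [a])

theorem step_letter {eS : D → List S} :
    WordComputable (fun p : A × D => Sum.inl p.1 :: (eS p.2).map Sum.inr) fun p => [p.1] := by
  simpa [List.flatMap_map, flatMap_nil] using
    (self (ea := fun p : A × D => Sum.inl p.1 :: (eS p.2).map Sum.inr)).flatMap
      (Sum.elim (fun a => [a]) fun _ => [])

theorem step_state {eS : D → List S} :
    WordComputable (fun p : A × D => Sum.inl p.1 :: (eS p.2).map Sum.inr) fun p => eS p.2 := by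
  simpa [List.flatMap_map, flatMap_nil] using
    (self (ea := fun p : A × D => Sum.inl p.1 :: (eS p.2).map Sum.inr)).flatMap
      (Sum.elim (fun _ => []) fun a => [a])

theorem length_emit_le {T : A → List Z → List B} {t : List Z} {p : Polynomial ℕ}
    (hp : ∀ a z, (T a z).length ≤ p.eval (z.length + 1)) (l : List A) (z : List Z) (n : ℕ)
    (hn : z.length + t.length * l.length ≤ n) :
    (emit T t z l).length ≤ l.length * p.eval (n + 1) := by
  induction l generalizing z with
  | nil => simp [emit]
  | cons a l ih =>
    have h1 := ih (z ++ t) (by simp only [List.length_append, List.length_cons] at *; nlinarith)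
    have h2 := (hp a z).trans (eval_mono p (by omega : z.length + 1 ≤ n + 1))
    simp only [emit, List.length_append, List.length_cons]
    nlinarith

/-- The iteration carries the counter word and the output side by side. The counter grows linearly,
so each block is polynomially long, and there are as many blocks as letters. -/
theorem emit {L : α → List A} {z : α → List Z} {T : A → List Z → List B} (t : List Z)
    (hT : WordComputable (fun p : A × List Z => Sum.inl p.1 :: p.2.map Sum.inr)
      fun p => T p.1 p.2)
    (hL : WordComputable ea L) (hz : WordComputable ea z) :
    WordComputable ea fun x => PolyTime.emit T t (z x) (L x) := by
  obtain ⟨p, hp⟩ := output_length_le hT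
  let step : A → List Z × List B → List Z × List B := fun a d => (d.1 ++ t, d.2 ++ T a d.1)
  have key : ∀ (l : List A) (z : List Z) (o : List B), (l.foldl (fun d a => step a d) (z, o)) =
      (z ++ (List.replicate l.length t).flatten, o ++ PolyTime.emit T t z l) := by
    intro l
    induction l with
    | nil => simp [PolyTime.emit]
    | cons a l ih => intro z o; simp [ih, step, PolyTime.emit, List.replicate_succ]
  have hstep : WordComputable
      (fun p : A × (List Z × List B) => Sum.inl p.1 :: (pairWord p.2).map Sum.inr)
      fun p => pairWord (step p.1 p.2) := by
    have h := step_state (A := A) (eS := pairWord (B := Z) (C := B))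
    refine pair (h.pairWord_left.append (const t)) (h.pairWord_right.append ?_)
    refine apply (eb := fun p : A × List Z => Sum.inl p.1 :: p.2.map Sum.inr) (ec := id)
      (f := fun p : A × (List Z × List B) => (p.1, p.2.1)) hT ?_
    have := step_letter.pair h.pairWord_left
    simpa using this
  have := foldl (eS := pairWord) (d := fun x => (z x, [])) (step := step) hL
    (hz.pair (const [])) hstep
    (.X + .C t.length * .X + .X * p.comp (.X + .C t.length * .X + 1)) (fun x l hl => by
      rw [key, length_pairWord]
      have hl' := hl.length_le
      have h1 := length_emit_le (t := t) (fun a z => by simpa using hp (a, z)) l (z x)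
        ((L x).length + (z x).length + t.length * ((L x).length + (z x).length)) (by nlinarith)
      simp only [length_pairWord, List.length_nil, add_zero, List.nil_append, List.length_append,
        List.length_flatten, List.map_replicate, List.sum_replicate, smul_eq_mul,
        Polynomial.eval_add, Polynomial.eval_mul, Polynomial.eval_X, Polynomial.eval_C,
        Polynomial.eval_comp, Polynomial.eval_one]
      refine Nat.add_le_add ?_ (h1.trans (Nat.mul_le_mul_right _ (by omega)))
      nlinarith)
  simpa [key] using this.pairWord_right

/-! ### Numbers in unary -/

theorem length_replicate (hF : WordComputable ea F) (b : B) :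
    WordComputable ea fun x => List.replicate (F x).length b := by
  simpa using hF.map fun _ => b

theorem replicate_add {u v : α → ℕ} {b : B} (hu : WordComputable ea fun x => List.replicate (u x) b)
    (hv : WordComputable ea fun x => List.replicate (v x) b) :
    WordComputable ea fun x => List.replicate (u x + v x) b := by
  simpa only [List.replicate_add] using hu.append hv

theorem replicate_mul {u v : α → ℕ} {b : B} (hu : WordComputable ea fun x => List.replicate (u x) b)
    (hv : WordComputable ea fun x => List.replicate (v x) b) :
    WordComputable ea fun x => List.replicate (u x * v x) b := by
  have key : ∀ n m : ℕ, PolyTime.emit (fun (_ : B) z => z) [] (List.replicate m b)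
      (List.replicate n b) = List.replicate (n * m) b := by
    intro n m
    induction n with
    | zero => simp [PolyTime.emit]
    | succ n ih =>
      rw [List.replicate_succ, PolyTime.emit, List.append_nil, ih, ← List.replicate_add]
      congr 1; ring
  simpa only [key] using emit (T := fun (_ : B) z => z) [] (step_state (eS := id)) hu hv

theorem replicate_eval (p : Polynomial ℕ) {u : α → ℕ} {b : B}
    (hu : WordComputable ea fun x => List.replicate (u x) b) :
    WordComputable ea fun x => List.replicate (p.eval (u x)) b := by
  induction p using Polynomial.induction_on with
  | C a => simpa using const _
  | add p q hp hq => simpa using replicate_add hp hq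
  | monomial n a h =>
    have := replicate_mul h hu
    simpa [pow_succ, mul_assoc] using this

theorem unaryEncodeNat_eq (n : ℕ) : Computability.unaryEncodeNat n = List.replicate n true := by
  induction n with
  | zero => rfl
  | succ n ih => rw [Computability.unaryEncodeNat, ih, List.replicate_succ]

theorem replicate_apply {f : ℕ → ℕ} (hf : PolynomiallyBounded f) {u : α → ℕ}
    (hu : WordComputable ea fun x => List.replicate (u x) true) :
    WordComputable ea fun x => List.replicate (f (u x)) true := by
  have := apply hf.2 (f := u) (ea := ea) (by simpa only [unaryEncodeNat_eq] using hu)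
  simpa only [unaryEncodeNat_eq] using this

/-! ### Splitting a word -/

/-- Each of the `u x` rounds moves one letter from the remaining word to the collected prefix, so
the total length never grows. -/
theorem splitAt {u : α → ℕ} (hu : WordComputable ea fun x => List.replicate (u x) true)
    (hF : WordComputable ea F) :
    WordComputable ea fun x => pairWord ((F x).drop (u x), (F x).take (u x)) := by
  let step : Bool → List A × List A → List A × List A := fun _ d => (d.1.tail, d.2 ++ d.1.take 1)
  have key : ∀ (n : ℕ) (l r : List A), (List.replicate n true).foldl (fun d a => step a d) (l, r) =
      (l.drop n, r ++ l.take n) := by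
    intro n
    induction n with
    | zero => simp
    | succ n ih =>
      intro l r
      rw [List.replicate_succ, List.foldl_cons]
      cases l <;> simp [step, ih]
  have hstep : WordComputable
      (fun p : Bool × (List A × List A) => Sum.inl p.1 :: (pairWord p.2).map Sum.inr)
      fun p => pairWord (step p.1 p.2) := by
    have h := step_state (A := Bool) (eS := pairWord (B := A) (C := A))
    exact h.pairWord_left.tail.pair (h.pairWord_right.append (h.pairWord_left.lookup 1 id))
  have := foldl_of_length_le (eS := pairWord) (d := fun x => (F x, [])) hu (hF.pair (const []))
    hstep 0 (fun a d => by
      simp only [length_pairWord, step, List.length_append, List.length_tail, List.length_take]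
      omega)
  simpa only [key, List.nil_append] using this

theorem take {u : α → ℕ} (hu : WordComputable ea fun x => List.replicate (u x) true)
    (hF : WordComputable ea F) : WordComputable ea fun x => (F x).take (u x) :=
  (splitAt hu hF).pairWord_right

theorem drop {u : α → ℕ} (hu : WordComputable ea fun x => List.replicate (u x) true)
    (hF : WordComputable ea F) : WordComputable ea fun x => (F x).drop (u x) :=
  (splitAt hu hF).pairWord_left

end WordComputable

end PolyTime

/-! ### States and gates -/

namespace PerfectCompleteness

open Function

variable {n m : ℕ}

/-- The state to which a list of gates leads. -/
noncomputable def run (gs : List (QGate n)) (ψ : QState n) : QState n :=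
  gs.foldl (fun ψ g => g.apply ψ) ψ

@[simp]
theorem run_nil (ψ : QState n) : run [] ψ = ψ := rfl

@[simp]
theorem run_cons (g : QGate n) (gs : List (QGate n)) (ψ : QState n) :
    run (g :: gs) ψ = run gs (g.apply ψ) := rfl

theorem run_append (gs hs : List (QGate n)) (ψ : QState n) :
    run (gs ++ hs) ψ = run hs (run gs ψ) := List.foldl_append

/-- The inner product of two states. -/
noncomputable def braket (φ ψ : QState n) : ℂ := ∑ b, star (φ b) * ψ b

/-- The probability that a measurement in the computational basis has an outcome with property
`p`. -/
noncomputable def prob (ψ : QState n) (p : (Fin n → Bool) → Bool) : ℝ :=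
  ∑ b, if p b then ‖ψ b‖ ^ 2 else 0

theorem sum_comp_involutive {R : Type*} [AddCommMonoid R] {π : (Fin n → Bool) → (Fin n → Bool)}
    (hπ : Involutive π) (f : (Fin n → Bool) → R) : ∑ b, f (π b) = ∑ b, f b :=
  Equiv.sum_comp hπ.toPerm f

theorem involutive_not (i : Fin n) : Involutive fun b : Fin n → Bool => update b i (!b i) := by
  intro b; simp

theorem involutive_toffoli {i j t : Fin n} (hit : i ≠ t) (hjt : j ≠ t) :
    Involutive fun b : Fin n → Bool => update b t (xor (b t) (b i && b j)) := by
  intro b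
  simp [update_of_ne hit, update_of_ne hjt]

/-- Pairing every index with its flip at `i` counts each index twice. A Hadamard gate mixes exactly
these pairs, so its identities are proved pair by pair. -/
theorem sum_update {R : Type*} [CommRing R] (i : Fin n) (f : (Fin n → Bool) → R) :
    ∑ b, (f (update b i false) + f (update b i true)) = 2 * ∑ b, f b := by
  have h : ∀ b : Fin n → Bool, f (update b i false) + f (update b i true) =
      f b + f (update b i (!b i)) := by
    intro b
    cases hb : b i
    · rw [show update b i false = b by rw [← hb, update_eq_self]]; rfl
    · rw [show update b i true = b by rw [← hb, update_eq_self], add_comm]; rfl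
  simp only [h]
  rw [Finset.sum_add_distrib, sum_comp_involutive (involutive_not i)]
  ring

theorem inv_sqrt_mul_self : ((Real.sqrt 2 : ℂ))⁻¹ * ((Real.sqrt 2 : ℂ))⁻¹ = 1 / 2 := by
  rw [← mul_inv, ← Complex.ofReal_mul, Real.mul_self_sqrt (by norm_num)]
  norm_num

theorem apply_apply (g : QGate n) (ψ : QState n) : g.apply (g.apply ψ) = ψ := by
  funext b
  cases g with
  | hadamard i =>
    have h := inv_sqrt_mul_self
    simp only [QGate.apply, update_idem, update_self]
    cases hb : b i
    · rw [show update b i false = b by rw [← hb, update_eq_self]]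
      simp only [Bool.false_eq_true, ite_false, ite_true]
      linear_combination (2 * ψ b) * h
    · rw [show update b i true = b by rw [← hb, update_eq_self]]
      simp only [Bool.false_eq_true, ite_false, ite_true]
      linear_combination (2 * ψ b) * h
  | not i => exact congrArg ψ (involutive_not i b)
  | toffoli i j t hij hit hjt => exact congrArg ψ (involutive_toffoli hit hjt b)

/-- Every gate is self-adjoint as well as an involution, hence unitary. Therefore the reversed list
of gates is both the inverse and the adjoint of the circuit. -/
theorem braket_apply (g : QGate n) (φ ψ : QState n) :
    braket φ (g.apply ψ) = braket (g.apply φ) ψ := by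
  cases g with
  | hadamard i =>
    have h2 : (2 : ℂ) ≠ 0 := two_ne_zero
    apply mul_left_cancel₀ h2
    unfold braket
    rw [← sum_update i, ← sum_update i]
    refine Finset.sum_congr rfl fun b _ => ?_
    simp [QGate.apply]
    ring
  | not i =>
    unfold braket
    rw [← sum_comp_involutive (involutive_not i)]
    simp [QGate.apply]
  | toffoli i j t hij hit hjt =>
    unfold braket
    rw [← sum_comp_involutive (involutive_toffoli hit hjt)]
    refine Finset.sum_congr rfl fun b _ => ?_
    exact congrArg (fun c => star (φ _) * ψ c) (involutive_toffoli hit hjt b)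

theorem braket_run_reverse (gs : List (QGate n)) (φ ψ : QState n) :
    braket φ (run gs.reverse ψ) = braket (run gs φ) ψ := by
  induction gs generalizing φ with
  | nil => rfl
  | cons g gs ih => rw [List.reverse_cons, run_append, run_cons, run_nil, braket_apply, ih, run_cons]

theorem braket_self (ψ : QState n) : braket ψ ψ = (prob ψ fun _ => true : ℝ) := by
  simp only [braket, prob, if_true, Complex.ofReal_sum]
  refine Finset.sum_congr rfl fun b _ => ?_
  rw [Complex.star_def, Complex.conj_mul']
  norm_cast

theorem prob_run_true (gs : List (QGate n)) (ψ : QState n) :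
    (prob (run gs ψ) fun _ => true) = prob ψ fun _ => true := by
  induction gs generalizing ψ with
  | nil => rfl
  | cons g gs ih =>
    rw [run_cons, ih]
    have h := braket_apply g (g.apply ψ) ψ
    rw [apply_apply, braket_self, braket_self] at h
    exact_mod_cast h

theorem prob_zero_true : (prob (QState.zero n) fun _ => true) = 1 := by
  simp only [prob, if_true, QState.zero]
  rw [Finset.sum_eq_single (fun _ => false)]
  · simp
  · intro b _ hb; simp [hb]
  · simp

theorem prob_add_prob_not (ψ : QState n) (p : (Fin n → Bool) → Bool) :
    prob ψ p + prob ψ (fun b => !p b) = prob ψ fun _ => true := by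
  simp only [prob, ← Finset.sum_add_distrib]
  refine Finset.sum_congr rfl fun b _ => ?_
  by_cases h : p b = true <;> simp [h]

theorem prob_congr {ψ : QState n} {p q : (Fin n → Bool) → Bool} (h : ∀ b, ψ b ≠ 0 → p b = q b) :
    prob ψ p = prob ψ q := by
  refine Finset.sum_congr rfl fun b _ => ?_
  by_cases hb : ψ b = 0
  · simp [hb]
  · rw [h b hb]

theorem prob_false (ψ : QState n) : (prob ψ fun _ => false) = 0 := by simp [prob]

theorem prob_nonneg (ψ : QState n) (p : (Fin n → Bool) → Bool) : 0 ≤ prob ψ p :=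
  Finset.sum_nonneg fun b _ => by split <;> positivity

/-- A classical gate permutes the basis, so an event after the gate pulls back to an event before
it. In this way probabilities at the end of a circuit are simplified gate by gate. -/
theorem prob_not (ψ : QState n) (i : Fin n) (p : (Fin n → Bool) → Bool) :
    prob ((QGate.not i).apply ψ) p = prob ψ fun b => p (update b i (!b i)) := by
  unfold prob
  rw [← sum_comp_involutive (involutive_not i)]
  refine Finset.sum_congr rfl fun b _ => ?_
  have := involutive_not i b
  simp only at this
  simp only [QGate.apply, this]

theorem prob_toffoli (ψ : QState n) {i j t : Fin n} (hij : i ≠ j) (hit : i ≠ t) (hjt : j ≠ t)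
    (p : (Fin n → Bool) → Bool) :
    prob ((QGate.toffoli i j t hij hit hjt).apply ψ) p =
      prob ψ fun b => p (update b t (xor (b t) (b i && b j))) := by
  unfold prob
  rw [← sum_comp_involutive (involutive_toffoli hit hjt)]
  refine Finset.sum_congr rfl fun b _ => ?_
  have := involutive_toffoli hit hjt b
  simp only at this
  simp only [QGate.apply, this]

/-- A Hadamard gate on a fresh qubit tosses a coin. -/
theorem prob_hadamard {ψ : QState n} {i : Fin n} (h : ∀ b, b i = true → ψ b = 0)
    (p : (Fin n → Bool) → Bool) :
    prob ((QGate.hadamard i).apply ψ) p =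
      (prob ψ p + prob ψ fun b => p (update b i true)) / 2 := by
  -- Freshness leaves one of the two terms, so there is no interference: both values of the qubit
  -- get half of the earlier weight, and the sign is invisible.
  have key : ∀ b, ‖(QGate.hadamard i).apply ψ b‖ ^ 2 = ‖ψ (update b i false)‖ ^ 2 / 2 := by
    intro b
    simp only [QGate.apply]
    rw [h (update b i true) (by simp), mul_zero, add_zero, norm_mul, mul_pow, norm_inv, inv_pow,
      Complex.norm_real, Real.norm_of_nonneg (Real.sqrt_nonneg 2), Real.sq_sqrt (by norm_num)]
    ring
  have h1 : 2 * prob ((QGate.hadamard i).apply ψ) p =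
      ∑ b, ((if p (update b i false) then ‖ψ (update b i false)‖ ^ 2 / 2 else 0) +
        if p (update b i true) then ‖ψ (update b i false)‖ ^ 2 / 2 else 0) := by
    rw [prob, ← sum_update i]
    refine Finset.sum_congr rfl fun b _ => ?_
    simp only [key, update_idem]
  have h2 : 2 * (prob ψ p + prob ψ fun b => p (update b i true)) =
      ∑ b, ((if p (update b i false) then ‖ψ (update b i false)‖ ^ 2 else 0) +
        if p (update b i true) then ‖ψ (update b i false)‖ ^ 2 else 0) := by
    rw [prob, prob, ← Finset.sum_add_distrib, ← sum_update i]
    refine Finset.sum_congr rfl fun b _ => ?_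
    rw [h (update b i true) (by simp)]
    simp only [update_idem]
    split_ifs <;> simp
  have h3 : ∑ b, ((if p (update b i false) then ‖ψ (update b i false)‖ ^ 2 else 0) +
        if p (update b i true) then ‖ψ (update b i false)‖ ^ 2 else 0) =
      2 * ∑ b, ((if p (update b i false) then ‖ψ (update b i false)‖ ^ 2 / 2 else 0) +
        if p (update b i true) then ‖ψ (update b i false)‖ ^ 2 / 2 else 0) := by
    rw [Finset.mul_sum]
    refine Finset.sum_congr rfl fun b _ => ?_
    split_ifs <;> ring
  linarith

/-- Two Hadamard gates around a NOT gate change the sign of the states in which the qubit is one. -/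
theorem run_phase (y : Fin n) (ψ : QState n) :
    run [.hadamard y, .not y, .hadamard y] ψ = fun b => if b y then -ψ b else ψ b := by
  funext b
  have h := inv_sqrt_mul_self
  simp only [run_cons, run_nil, QGate.apply, update_idem, update_self, Bool.not_false, Bool.not_true]
  cases hb : b y
  · rw [show update b y false = b by rw [← hb, update_eq_self]]
    simp only [Bool.false_eq_true, ite_false, ite_true]
    linear_combination (2 * ψ b) * h
  · rw [show update b y true = b by rw [← hb, update_eq_self]]
    simp only [Bool.false_eq_true, ite_false, ite_true]
    linear_combination (-2 * ψ b) * h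

/-- This is the expectation of a Pauli Z: the weight with `y` zero minus the weight with `y` one. -/
theorem braket_phase (y : Fin n) (ψ : QState n) :
    braket ψ (fun b => if b y then -ψ b else ψ b) =
      ((prob ψ fun _ => true) - 2 * prob ψ fun b => b y : ℝ) := by
  simp only [braket, prob, if_true, Finset.mul_sum, ← Finset.sum_sub_distrib, Complex.ofReal_sum]
  refine Finset.sum_congr rfl fun b _ => ?_
  have : star (ψ b) * ψ b = (‖ψ b‖ ^ 2 : ℝ) := by
    rw [Complex.star_def, Complex.conj_mul']
    norm_cast
  by_cases hy : b y = true
  · simp only [hy, if_true, mul_neg, this]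
    push_cast; ring
  · simp only [hy, Bool.false_eq_true, if_false, this]
    simp

theorem braket_zero (ψ : QState n) : braket (QState.zero n) ψ = ψ fun _ => false := by
  unfold braket QState.zero
  rw [Finset.sum_eq_single (fun _ => false)]
  · simp
  · intro b _ hb; simp [hb]
  · simp

/-! ### Additional qubits -/

/-- A gate on a larger number of qubits. -/
def lift (h : n ≤ m) : QGate n → QGate m
  | .hadamard i => .hadamard (i.castLE h)
  | .not i => .not (i.castLE h)
  | .toffoli i j t hij hit hjt => .toffoli (i.castLE h) (j.castLE h) (t.castLE h)
      (fun e => hij (Fin.castLE_injective h e)) (fun e => hit (Fin.castLE_injective h e))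
      (fun e => hjt (Fin.castLE_injective h e))

theorem encode_lift (h : n ≤ m) (g : QGate n) : (lift h g).encode = g.encode := by
  cases g <;> rfl

/-- A basis state with additional qubits that are zero. -/
def pad (m : ℕ) (b : Fin n → Bool) : Fin m → Bool := fun i =>
  if h : i.val < n then b ⟨i, h⟩ else false

/-- A state with additional qubits that are zero. -/
noncomputable def extend (h : n ≤ m) (ψ : QState n) : QState m := fun b =>
  if ∀ i : Fin m, n ≤ i.val → b i = false then ψ (fun i => b (i.castLE h)) else 0

theorem extend_pad (h : n ≤ m) (ψ : QState n) (b : Fin n → Bool) : extend h ψ (pad m b) = ψ b := by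
  rw [extend, if_pos (fun i hi => by simp [pad, Nat.not_lt.2 hi])]
  congr 1
  funext i
  simp [pad]

theorem pad_restrict (h : n ≤ m) {b : Fin m → Bool} (hb : ∀ i : Fin m, n ≤ i.val → b i = false) :
    pad m (fun i => b (i.castLE h)) = b := by
  funext i
  unfold pad
  split
  · rfl
  · rw [hb i (by omega)]

theorem pad_injective (h : n ≤ m) : Injective (pad m : (Fin n → Bool) → Fin m → Bool) := by
  intro b c hbc
  funext i
  simpa [pad] using congrFun hbc (i.castLE h)

theorem prob_extend (h : n ≤ m) (ψ : QState n) (p : (Fin m → Bool) → Bool) :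
    prob (extend h ψ) p = prob ψ fun b => p (pad m b) := by
  symm
  refine Fintype.sum_of_injective (pad m) (pad_injective h) _ _ (fun b hb => ?_) fun b => ?_
  · have : extend h ψ b = 0 := if_neg fun hb' => hb ⟨_, pad_restrict h hb'⟩
    simp [this]
  · rw [extend_pad]

theorem restrict_update (h : n ≤ m) (b : Fin m → Bool) (i : Fin n) (v : Bool) :
    (fun j : Fin n => update b (i.castLE h) v (j.castLE h)) =
      update (fun j : Fin n => b (j.castLE h)) i v :=
  update_comp_eq_of_injective b (Fin.castLE_injective h) i v

theorem extend_update (h : n ≤ m) (ψ : QState n) (b : Fin m → Bool) (i : Fin n) (v : Bool) :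
    extend h ψ (update b (i.castLE h) v) =
      if ∀ i : Fin m, n ≤ i.val → b i = false then ψ (update (fun j : Fin n => b (j.castLE h)) i v)
      else 0 := by
  have : (∀ k : Fin m, n ≤ k.val → update b (i.castLE h) v k = false) ↔
      ∀ k : Fin m, n ≤ k.val → b k = false := by
    refine forall_congr' fun k => imp_congr_right fun hk => ?_
    rw [update_of_ne]
    rintro rfl
    have := i.isLt
    simp at hk
    omega
  rw [extend, restrict_update]
  simp only [this]

theorem apply_lift (h : n ≤ m) (g : QGate n) (ψ : QState n) :
    (lift h g).apply (extend h ψ) = extend h (g.apply ψ) := by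
  funext b
  cases g with
  | hadamard i =>
    simp only [lift, QGate.apply, extend_update]
    simp only [extend]
    split_ifs <;> simp
  | not i =>
    simp only [lift, QGate.apply, extend_update]
    simp only [extend]
  | toffoli i j t hij hit hjt =>
    simp only [lift, QGate.apply, extend_update]
    simp only [extend]

theorem run_lift (h : n ≤ m) (gs : List (QGate n)) (ψ : QState n) :
    run (gs.map (lift h)) (extend h ψ) = extend h (run gs ψ) := by
  induction gs generalizing ψ with
  | nil => rfl
  | cons g gs ih => rw [List.map_cons, run_cons, apply_lift, ih, run_cons]

theorem extend_zero (h : n ≤ m) : extend h (QState.zero n) = QState.zero m := by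
  funext b
  by_cases hb : b = fun _ => false
  · subst hb
    simp [extend, QState.zero]
  · rw [show QState.zero m b = 0 from Pi.single_eq_of_ne hb _, extend]
    split
    · rename_i hb'
      rw [QState.zero, Pi.single_eq_of_ne]
      intro e
      apply hb
      rw [← pad_restrict h hb', e]
      funext i
      simp [pad]
    · rfl

end PerfectCompleteness

/-! ### The rewinding circuit -/

namespace PerfectCompleteness

open Function

variable {n m : ℕ}

/-- The qubits from `t` on are zero. -/
def FreshFrom (t : ℕ) (ψ : QState n) : Prop :=
  ∀ (b : Fin n → Bool) (i : Fin n), t ≤ i.val → b i = true → ψ b = 0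

theorem FreshFrom.mono {s t : ℕ} {ψ : QState n} (h : FreshFrom s ψ) (hst : s ≤ t) :
    FreshFrom t ψ :=
  fun b i hi => h b i (hst.trans hi)

theorem FreshFrom.hadamard {t : ℕ} {ψ : QState n} (h : FreshFrom t ψ) {i : Fin n} (hi : i.val < t) :
    FreshFrom t ((QGate.hadamard i).apply ψ) := by
  intro b k hk hb
  have hki : k ≠ i := by rintro rfl; omega
  simp only [QGate.apply]
  rw [h _ k hk (by rw [update_of_ne hki, hb]), h _ k hk (by rw [update_of_ne hki, hb])]
  simp

theorem FreshFrom.not {t : ℕ} {ψ : QState n} (h : FreshFrom t ψ) {i : Fin n} (hi : i.val < t) :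
    FreshFrom t ((QGate.not i).apply ψ) := by
  intro b k hk hb
  have hki : k ≠ i := by rintro rfl; omega
  exact h _ k hk (by rw [update_of_ne hki, hb])

theorem FreshFrom.toffoli {t : ℕ} {ψ : QState n} (h : FreshFrom t ψ) {i j k : Fin n} (hij : i ≠ j)
    (hik : i ≠ k) (hjk : j ≠ k) (hk : k.val < t) :
    FreshFrom t ((QGate.toffoli i j k hij hik hjk).apply ψ) := by
  intro b l hl hb
  have hlk : l ≠ k := by rintro rfl; omega
  exact h _ l hl (by rw [update_of_ne hlk, hb])

theorem freshFrom_extend (h : n ≤ m) (ψ : QState n) : FreshFrom n (extend h ψ) := by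
  intro b i hi hb
  refine if_neg fun h' => ?_
  rw [h' i hi] at hb
  cases hb

/-- With a coin in qubit `j + 1`, qubit `j + 2` becomes either qubit `j` or the given bit. -/
def coinStep (j : ℕ) (h : j + 2 < n) (b : Bool) : List (QGate n) :=
  [.hadamard ⟨j + 1, by omega⟩] ++ (if b then [.not ⟨j, by omega⟩] else []) ++
    [.toffoli ⟨j + 1, by omega⟩ ⟨j, by omega⟩ ⟨j + 2, h⟩ (by simp) (by simp) (by simp)] ++
    (if b then [.not ⟨j + 2, h⟩] else [])

theorem freshFrom_coinStep {j : ℕ} (h : j + 2 < n) (b : Bool) {ψ : QState n}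
    (hψ : FreshFrom (j + 1) ψ) : FreshFrom (j + 3) (run (coinStep j h b) ψ) := by
  have h0 := hψ.mono (show j + 1 ≤ j + 3 by omega)
  have h1 := h0.hadamard (i := ⟨j + 1, by omega⟩) (by simp)
  cases b
  · exact h1.toffoli (by simp) (by simp) (by simp) (by simp)
  · exact ((h1.not (by simp)).toffoli (by simp) (by simp) (by simp) (by simp)).not (by simp)

/-- The output qubit of `V` lies below the ladder and has to survive it, since the mixing step reads
it afterwards. -/
theorem prob_coinStep_of_lt {j : ℕ} (h : j + 2 < n) (b : Bool) {ψ : QState n}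
    (hψ : FreshFrom (j + 1) ψ) {o : Fin n} (ho : o.val < j) :
    (prob (run (coinStep j h b) ψ) fun c => c o) = prob ψ fun c => c o := by
  have hf : ∀ c : Fin n → Bool, c ⟨j + 1, by omega⟩ = true → ψ c = 0 :=
    fun c hc => hψ c _ (by simp) hc
  have e0 : o ≠ ⟨j, by omega⟩ := fun e => by rw [e] at ho; simp at ho
  have e1 : o ≠ ⟨j + 1, by omega⟩ := fun e => by rw [e] at ho; simp at ho
  have e2 : o ≠ ⟨j + 2, by omega⟩ := fun e => by rw [e] at ho; simp at ho
  cases b <;> simp [coinStep, prob_toffoli, prob_not, prob_hadamard hf, e0, e1, e2]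

/-- For a digit zero the target becomes the conjunction of the coin and qubit `j`. For a digit one,
the NOT gates turn it into the disjunction of qubit `j` and the negated coin. In both cases
freshness makes the Toffoli gate write instead of toggle. -/
theorem prob_coinStep {j : ℕ} (h : j + 2 < n) (b : Bool) {ψ : QState n}
    (hψ : FreshFrom (j + 1) ψ) :
    (prob (run (coinStep j h b) ψ) fun c => c ⟨j + 2, h⟩) =
      ((if b then prob ψ fun _ => true else 0) + prob ψ fun c => c ⟨j, by omega⟩) / 2 := by
  have hf : ∀ c : Fin n → Bool, c ⟨j + 1, by omega⟩ = true → ψ c = 0 :=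
    fun c hc => hψ c _ (by simp) hc
  have h1 : ∀ c, ψ c ≠ 0 → c ⟨j + 1, by omega⟩ = false := fun c hc => by
    by_contra h'
    exact hc (hψ c ⟨j + 1, by omega⟩ (by simp) (by simpa using h'))
  have h2 : ∀ c, ψ c ≠ 0 → c ⟨j + 2, h⟩ = false := fun c hc => by
    by_contra h'
    exact hc (hψ c ⟨j + 2, by omega⟩ (by simp) (by simpa using h'))
  cases b
  · simp only [coinStep, Bool.false_eq_true, if_false, List.append_nil, List.singleton_append,
      run_cons, run_nil, prob_toffoli, prob_hadamard hf]
    congr 2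
    · rw [← prob_false ψ]
      exact prob_congr fun c hc => by simp [h1 c hc, h2 c hc]
    · exact prob_congr fun c hc => by simp [h2 c hc]
  · simp only [coinStep, if_true, List.cons_append, List.nil_append, run_cons, run_nil, prob_toffoli, prob_not, prob_hadamard hf]
    congr 2
    · exact prob_congr fun c hc => by simp [h1 c hc, h2 c hc]
    · exact prob_congr fun c hc => by simp [h2 c hc]

/-- A sequence of coin steps, one for each bit of a list. -/
def ladder (n : ℕ) : (j : ℕ) → (l : List Bool) → j + 2 * l.length < n → List (QGate n)
  | _, [], _ => []
  | j, b :: l, h => coinStep j (by simp only [List.length_cons] at h; omega) b ++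
      ladder n (j + 2) l (by simp only [List.length_cons] at h; omega)

/-- The number with the given binary digits, the least significant one first. -/
def ofBits : List Bool → ℕ
  | [] => 0
  | b :: l => b.toNat + 2 * ofBits l

theorem freshFrom_ladder {j : ℕ} {l : List Bool} (h : j + 2 * l.length < n) {ψ : QState n}
    (hψ : FreshFrom (j + 1) ψ) : FreshFrom (j + 2 * l.length + 1) (run (ladder n j l h) ψ) := by
  induction l generalizing j ψ with
  | nil => exact hψ
  | cons b l ih =>
    simp only [List.length_cons] at h
    rw [ladder, run_append]
    exact (ih (j := j + 2) (by omega) (freshFrom_coinStep _ b hψ)).mono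
      (by simp only [List.length_cons]; omega)

theorem prob_ladder_of_lt {j : ℕ} {l : List Bool} (h : j + 2 * l.length < n) {ψ : QState n}
    (hψ : FreshFrom (j + 1) ψ) {o : Fin n} (ho : o.val < j) :
    (prob (run (ladder n j l h) ψ) fun c => c o) = prob ψ fun c => c o := by
  induction l generalizing j ψ with
  | nil => rfl
  | cons b l ih =>
    simp only [List.length_cons] at h
    rw [ladder, run_append, ih (j := j + 2) (by omega) (freshFrom_coinStep _ b hψ) (by omega),
      prob_coinStep_of_lt _ _ hψ ho]

/-- A ladder turns binary digits into a probability. -/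
theorem prob_ladder {j : ℕ} {l : List Bool} (h : j + 2 * l.length < n) {ψ : QState n}
    (hψ : FreshFrom (j + 1) ψ) (hψ' : (prob ψ fun _ => true) = 1) :
    (prob (run (ladder n j l h) ψ) fun c => c ⟨j + 2 * l.length, h⟩) =
      ((prob ψ fun c => c ⟨j, by omega⟩) + ofBits l) / 2 ^ l.length := by
  induction l generalizing j ψ with
  | nil => simp [ladder, ofBits]
  | cons b l ih =>
    simp only [List.length_cons] at h
    -- Horner's scheme: each step adds a digit and halves, so the digits are used from the least
    -- significant one on.
    have h1 := ih (j := j + 2) (by omega) (freshFrom_coinStep (n := n) (by omega) b hψ)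
      (by rw [prob_run_true, hψ'])
    rw [prob_coinStep _ _ hψ, hψ'] at h1
    have e : (⟨j + 2 * (b :: l).length, h⟩ : Fin n) = ⟨j + 2 + 2 * l.length, by omega⟩ := by
      ext; simp only [List.length_cons]; ring
    rw [ladder, run_append, e, h1, ofBits, List.length_cons, pow_succ]
    cases b
    · simp; field_simp
    · simp; field_simp; ring

/-- With a coin in qubit `j + 1`, qubit `j + 2` becomes either qubit `o` or qubit `j`. -/
def mixStep (j : ℕ) (h : j + 2 < n) (o : ℕ) (ho : o < j) : List (QGate n) :=
  [.hadamard ⟨j + 1, by omega⟩,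
    .toffoli ⟨j + 1, by omega⟩ ⟨o, by omega⟩ ⟨j + 2, h⟩ (by simp; omega) (by simp) (by simp; omega),
    .not ⟨j + 1, by omega⟩,
    .toffoli ⟨j + 1, by omega⟩ ⟨j, by omega⟩ ⟨j + 2, h⟩ (by simp) (by simp) (by simp)]

/-- The coin is negated between the two Toffoli gates, so exactly one of them is enabled and the
target, initially zero, receives a copy of one source. -/
theorem prob_mixStep {j : ℕ} (h : j + 2 < n) {o : ℕ} (ho : o < j) {ψ : QState n}
    (hψ : FreshFrom (j + 1) ψ) :
    (prob (run (mixStep j h o ho) ψ) fun c => c ⟨j + 2, h⟩) =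
      ((prob ψ fun c => c ⟨j, by omega⟩) + prob ψ fun c => c ⟨o, by omega⟩) / 2 := by
  have hf : ∀ c : Fin n → Bool, c ⟨j + 1, by omega⟩ = true → ψ c = 0 :=
    fun c hc => hψ c _ (by simp) hc
  have h1 : ∀ c, ψ c ≠ 0 → c ⟨j + 1, by omega⟩ = false := fun c hc => by
    by_contra h'
    exact hc (hψ c ⟨j + 1, by omega⟩ (by simp) (by simpa using h'))
  have h2 : ∀ c, ψ c ≠ 0 → c ⟨j + 2, h⟩ = false := fun c hc => by
    by_contra h'
    exact hc (hψ c ⟨j + 2, by omega⟩ (by simp) (by simpa using h'))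
  have e : o ≠ j + 1 := by omega
  simp only [mixStep, run_cons, run_nil, prob_toffoli, prob_not, prob_hadamard hf]
  congr 2
  · exact prob_congr fun c hc => by simp [h1 c hc, h2 c hc]
  · exact prob_congr fun c hc => by simp [h2 c hc, e]

/-! ### The final check -/

/-- The permutation of the basis states by a gate that is not a Hadamard gate. -/
def permute : QGate n → (Fin n → Bool) → Fin n → Bool
  | .hadamard _, b => b
  | .not i, b => update b i (!b i)
  | .toffoli i j t _ _ _, b => update b t (xor (b t) (b i && b j))

/-- The gate is not a Hadamard gate. -/
def IsClassical : QGate n → Prop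
  | .hadamard _ => False
  | _ => True

theorem prob_run_of_isClassical {gs : List (QGate n)} (h : ∀ g ∈ gs, IsClassical g) (ψ : QState n)
    (p : (Fin n → Bool) → Bool) :
    prob (run gs ψ) p = prob ψ fun b => p (gs.foldl (fun b g => permute g b) b) := by
  induction gs generalizing ψ with
  | nil => rfl
  | cons g gs ih =>
    rw [run_cons, ih fun g hg => h g (List.mem_cons_of_mem _ hg)]
    cases g with
    | hadamard i => exact (h _ List.mem_cons_self).elim
    | not i => exact prob_not _ _ _
    | toffoli i j t hij hit hjt => exact prob_toffoli _ hij hit hjt _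

/-- The flag in qubit `m + i + 1` is the conjunction of the flag in qubit `m + i` and the
negation of qubit `i`. -/
def checkStep (m i : ℕ) (h : i < m) : List (QGate (2 * m + 1)) :=
  [.not ⟨i, by omega⟩, .toffoli ⟨i, by omega⟩ ⟨m + i, by omega⟩ ⟨m + (i + 1), by omega⟩
    (by simp; omega) (by simp; omega) (by simp)]

/-- The check steps for `k` qubits, the first of which is `i`. -/
def checkSteps (m : ℕ) : (i k : ℕ) → i + k ≤ m → List (QGate (2 * m + 1))
  | _, 0, _ => []
  | i, k + 1, h => checkStep m i (by omega) ++ checkSteps m (i + 1) k (by omega)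

theorem isClassical_checkSteps {m i k : ℕ} (h : i + k ≤ m) :
    ∀ g ∈ checkSteps m i k h, IsClassical g := by
  induction k generalizing i with
  | zero => simp [checkSteps]
  | succ k ih =>
    intro g hg
    rw [checkSteps, List.mem_append] at hg
    rcases hg with hg | hg
    · simp only [checkStep, List.mem_cons, List.not_mem_nil, or_false] at hg
      rcases hg with rfl | rfl <;> trivial
    · exact ih (by omega) g hg

/-- The hypothesis says that later flags are still zero, so each Toffoli gate writes its
conjunction. A step leaves qubit `i` negated, which is harmless because later steps do not read it.
-/
theorem foldl_checkSteps {m i k : ℕ} (h : i + k ≤ m) (b : Fin (2 * m + 1) → Bool)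
    (hb : ∀ j : Fin (2 * m + 1), m + i < j.val → b j = false) :
    (checkSteps m i k h).foldl (fun b g => permute g b) b ⟨m + (i + k), by omega⟩ = true ↔
      b ⟨m + i, by omega⟩ = true ∧ ∀ j : Fin (2 * m + 1), i ≤ j.val → j.val < i + k →
        b j = false := by
  induction k generalizing i b with
  | zero => simp [checkSteps]; intros; omega
  | succ k ih =>
    rw [checkSteps, List.foldl_append]
    set b' := (checkStep m i (by omega)).foldl (fun b g => permute g b) b with hb'
    have e1 : ∀ j : Fin (2 * m + 1), j.val ≠ i → j.val ≠ m + (i + 1) → b' j = b j := by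
      intro j h1 h2
      have h1' : j ≠ ⟨i, by omega⟩ := fun e => h1 (congrArg Fin.val e)
      have h2' : j ≠ ⟨m + (i + 1), by omega⟩ := fun e => h2 (congrArg Fin.val e)
      simp [hb', checkStep, permute, h1', h2']
    have e2 : b' ⟨m + (i + 1), by omega⟩ = (!b ⟨i, by omega⟩ && b ⟨m + i, by omega⟩) := by
      have h1 : m + (i + 1) ≠ i := by omega
      have h2 : m ≠ 0 := by omega
      have h3 := hb ⟨m + (i + 1), by omega⟩ (by simp)
      simp [hb', checkStep, permute, h1, h2, h3]
    have := ih (i := i + 1) (by omega) b' (fun j hj => by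
      rw [e1 j (by omega) (by omega)]; exact hb j (by omega))
    have e3 : (⟨m + (i + (k + 1)), by omega⟩ : Fin (2 * m + 1)) = ⟨m + (i + 1 + k), by omega⟩ := by
      ext; simp; ring
    rw [e3, this, e2]
    simp only [Bool.and_eq_true, Bool.not_eq_true']
    constructor
    · rintro ⟨⟨h1, h2⟩, h3⟩
      refine ⟨h2, fun j hj hj' => ?_⟩
      rcases Nat.lt_or_ge i j.val with hij | hij
      · rw [← e1 j (by omega) (by omega)]
        exact h3 j (by omega) (by omega)
      · rw [← h1]; congr 1; ext; simp; omega
    · rintro ⟨h1, h2⟩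
      refine ⟨⟨h2 _ (by simp) (by simp), h1⟩, fun j hj hj' => ?_⟩
      rw [e1 j (by omega) (by omega)]
      exact h2 j (by omega) (by omega)

/-- The gates that compute in the last qubit whether one of the first `m` qubits is not zero. -/
def check (m : ℕ) : List (QGate (2 * m + 1)) :=
  [.not ⟨m, by omega⟩] ++ checkSteps m 0 m (by omega) ++ [.not ⟨2 * m, by omega⟩]

theorem prob_check {m : ℕ} (h : m ≤ 2 * m + 1) (ψ : QState m) :
    (prob (run (check m) (extend h ψ)) fun b => b ⟨2 * m, by omega⟩) =
      (prob ψ fun _ => true) - ‖ψ fun _ => false‖ ^ 2 := by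
  have hc : ∀ g ∈ check m, IsClassical g := by
    intro g hg
    simp only [check, List.mem_append, List.mem_singleton] at hg
    rcases hg with (rfl | hg) | rfl
    · trivial
    · exact isClassical_checkSteps _ g hg
    · trivial
  have key : ∀ b : Fin m → Bool, (check m).foldl (fun b g => permute g b) (pad (2 * m + 1) b)
      ⟨2 * m, by omega⟩ = !decide (b = fun _ => false) := by
    intro b
    rw [check, List.foldl_append, List.foldl_append]
    change (update _ _ (!_) : Fin (2 * m + 1) → Bool) _ = _
    rw [update_self]
    congr 1
    have := foldl_checkSteps (m := m) (i := 0) (k := m) (by omega)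
      (update (pad (2 * m + 1) b) ⟨m, by omega⟩ (!pad (2 * m + 1) b ⟨m, by omega⟩)) (by
        intro j hj
        rw [update_of_ne (by intro e; simp [e] at hj)]
        simp only [pad]
        rw [dif_neg (by omega)])
    have e : (⟨2 * m, by omega⟩ : Fin (2 * m + 1)) = ⟨m + (0 + m), by omega⟩ := by
      ext; simp; ring
    rw [Bool.eq_iff_iff, e, decide_eq_true_iff]
    refine this.trans ?_
    constructor
    · rintro ⟨-, h2⟩
      funext i
      have := h2 (i.castLE h) (by simp) (by simp)
      rw [update_of_ne (by intro e; have := congrArg Fin.val e; simp at this; omega)] at this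
      simpa [pad] using this
    · rintro rfl
      refine ⟨by simp [pad], fun j _ hj => ?_⟩
      rw [update_of_ne (by intro e; simp [e] at hj)]
      simp [pad]
  rw [prob_run_of_isClassical hc, prob_extend]
  simp only [key]
  have h1 := prob_add_prob_not ψ fun b => decide (b = fun _ => false)
  have h2 : (prob ψ fun b => decide (b = fun _ => false)) = ‖ψ fun _ => false‖ ^ 2 := by
    unfold prob
    rw [Finset.sum_eq_single (fun _ => false)]
    · simp
    · intro b _ hb; simp [hb]
    · simp
  linarith

/-- The circuit that runs the given gates, changes the sign of the states in which qubit `y` is one,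
runs the gates backwards and accepts if the state is not the initial state. -/
def rewind (m : ℕ) (gs : List (QGate m)) (y : Fin m) : QCircuit where
  width := 2 * m + 1
  gates := (gs ++ [QGate.hadamard y, QGate.not y, QGate.hadamard y] ++ gs.reverse).map
    (lift (by omega)) ++ check m
  output := ⟨2 * m, by omega⟩

/-- Moving the reversed gates to the other side of the inner product makes the final amplitude of
the initial state the expectation of the sign change in the state before it. This is 1 - 2P, where P
is the probability of a one in `y`; the check accepts on the remaining weight. -/
theorem acceptProb_rewind (m : ℕ) (gs : List (QGate m)) (y : Fin m) :
    (rewind m gs y).acceptProb =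
      1 - (1 - 2 * prob (run gs (QState.zero m)) fun b => b y) ^ 2 := by
  have h1 : (rewind m gs y).acceptProb = prob (run ((gs ++
      [QGate.hadamard y, QGate.not y, QGate.hadamard y] ++ gs.reverse).map (lift (by omega)) ++ check m) (QState.zero (2 * m + 1)))
      fun b => b ⟨2 * m, by omega⟩ := rfl
  rw [h1, run_append, ← extend_zero (by omega : m ≤ 2 * m + 1), run_lift, prob_check, prob_run_true,
    prob_zero_true, run_append, run_append, run_phase, ← braket_zero (run _ _), braket_run_reverse,
    braket_phase, prob_run_true, prob_zero_true, Complex.norm_real, Real.norm_eq_abs, sq_abs]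

end PerfectCompleteness

/-! ### Balancing a circuit with the digits from the witness -/

namespace PerfectCompleteness

open Function

/-- The gates of a circuit, with additional qubits, the last of which becomes the average of the
output and of a probability with the given binary digits. -/
def mixture (V : QCircuit) (l : List Bool) : List (QGate (V.width + 2 * l.length + 3)) :=
  V.gates.map (lift (by omega)) ++ ladder _ V.width l (by omega) ++
    mixStep (V.width + 2 * l.length) (by omega) V.output (by omega)

theorem acceptProb_eq_prob (V : QCircuit) :
    V.acceptProb = prob (run V.gates (QState.zero V.width)) fun b => b V.output := rfl

theorem prob_mixture (V : QCircuit) (l : List Bool) :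
    (prob (run (mixture V l) (QState.zero _)) fun b => b ⟨V.width + 2 * l.length + 2, by omega⟩) =
      (V.acceptProb + ofBits l / 2 ^ l.length) / 2 := by
  have h : V.width ≤ V.width + 2 * l.length + 3 := by omega
  have hf := (freshFrom_extend h (run V.gates (QState.zero _))).mono (Nat.le_succ V.width)
  rw [mixture, run_append, run_append, ← extend_zero h, run_lift,
    prob_mixStep _ _ (freshFrom_ladder _ hf),
    prob_ladder_of_lt _ hf (o := ⟨V.output, by omega⟩) V.output.isLt,
    prob_ladder _ hf (by rw [prob_extend, prob_run_true, prob_zero_true]), prob_extend, prob_extend,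
    acceptProb_eq_prob]
  -- The ladder starts from the first additional qubit, which is zero and therefore contributes
  -- nothing to the probability made from the digits.
  have h0 : (fun b : Fin V.width → Bool => pad (V.width + 2 * l.length + 3) b
      ⟨V.width, by omega⟩) = fun _ => false := by
    funext b; simp [pad]
  have h1 : (fun b : Fin V.width → Bool => pad (V.width + 2 * l.length + 3) b
      ⟨V.output, by omega⟩) = fun b => b V.output := by
    funext b; simp [pad]
  rw [h0, h1, prob_false]
  ring

/-- The circuit that accepts with certainty if the acceptance probability of `V` and the number in
the interval `[0, 1)` with the given binary digits add up to one. -/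
def perfect (V : QCircuit) (l : List Bool) : QCircuit :=
  rewind (V.width + 2 * l.length + 3) (mixture V l) ⟨V.width + 2 * l.length + 2, by omega⟩

theorem acceptProb_perfect (V : QCircuit) (l : List Bool) :
    (perfect V l).acceptProb = 1 - (1 - V.acceptProb - ofBits l / 2 ^ l.length) ^ 2 := by
  rw [perfect, acceptProb_rewind, prob_mixture]
  ring

/-- A circuit that never accepts. -/
def reject : QCircuit where
  width := 1
  gates := []
  output := 0

theorem acceptProb_reject : reject.acceptProb = 0 := by
  rw [acceptProb_eq_prob, ← prob_false (QState.zero 1)]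
  refine prob_congr fun b hb => ?_
  by_contra h
  refine hb (Pi.single_eq_of_ne ?_ _)
  rintro rfl
  exact h rfl

theorem acceptProb_le_one (V : QCircuit) : V.acceptProb ≤ 1 := by
  have h := prob_add_prob_not (run V.gates (QState.zero _)) fun b => b V.output
  rw [prob_run_true, prob_zero_true] at h
  rw [acceptProb_eq_prob]
  linarith [prob_nonneg (run V.gates (QState.zero _)) fun b => !b V.output]

/-! ### Acceptance probabilities are dyadic rationals -/

/-- A Hadamard gate maps integer vectors to integer vectors, apart from one more factor 1/√2 common
to all coordinates; the other gates permute the coordinates. -/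
theorem exists_int_run {n : ℕ} (gs : List (QGate n)) {ψ : QState n} {h : ℕ}
    {φ : (Fin n → Bool) → ℤ} (hψ : ∀ b, ψ b = φ b * ((Real.sqrt 2 : ℂ)⁻¹) ^ h) :
    ∃ h' ≤ h + gs.length, ∃ φ' : (Fin n → Bool) → ℤ,
      ∀ b, run gs ψ b = φ' b * ((Real.sqrt 2 : ℂ)⁻¹) ^ h' := by
  induction gs generalizing ψ h φ with
  | nil => exact ⟨h, by simp, φ, hψ⟩
  | cons g gs ih =>
    have : ∃ h₁ ≤ h + 1, ∃ φ₁ : (Fin n → Bool) → ℤ,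
        ∀ b, g.apply ψ b = φ₁ b * ((Real.sqrt 2 : ℂ)⁻¹) ^ h₁ := by
      cases g with
      | hadamard i =>
        refine ⟨h + 1, le_rfl, fun b => φ (update b i false) +
          (if b i then -1 else 1) * φ (update b i true), fun b => ?_⟩
        simp only [QGate.apply, hψ]
        push_cast
        ring
      | not i => exact ⟨h, by omega, fun b => φ _, fun b => hψ _⟩
      | toffoli i j t _ _ _ => exact ⟨h, by omega, fun b => φ _, fun b => hψ _⟩
    obtain ⟨h₁, hh, φ₁, hφ⟩ := this
    obtain ⟨h₂, hh', φ₂, hφ'⟩ := ih hφ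
    exact ⟨h₂, by simp only [List.length_cons]; omega, φ₂, hφ'⟩

/-- Squaring the amplitudes removes the square root and gives the denominator `2 ^ h`, where `h` is
at most the number of gates. The factor `2 ^ (l - h)` in the witness raises it to `2 ^ l`. -/
theorem exists_acceptProb_eq (V : QCircuit) {l : ℕ} (hl : V.gates.length ≤ l) :
    ∃ k : ℕ, V.acceptProb = k / 2 ^ l := by
  obtain ⟨h, hh, φ, hφ⟩ := exists_int_run V.gates (ψ := QState.zero V.width) (h := 0)
    (φ := Pi.single (fun _ => false) 1) (fun b => by
      by_cases hb : b = fun _ => false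
      · subst hb; simp [QState.zero]
      · simp [QState.zero, hb])
  rw [zero_add] at hh
  refine ⟨∑ b : Fin V.width → Bool, if b V.output then (φ b).natAbs ^ 2 * 2 ^ (l - h) else 0, ?_⟩
  rw [acceptProb_eq_prob, prob, Nat.cast_sum, Finset.sum_div]
  refine Finset.sum_congr rfl fun b _ => ?_
  split_ifs
  · rw [hφ, norm_mul, norm_pow, norm_inv, Complex.norm_real, Real.norm_of_nonneg (Real.sqrt_nonneg 2),
      mul_pow, ← pow_mul, mul_comm h 2, pow_mul, inv_pow, Real.sq_sqrt (by norm_num),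
      Complex.norm_intCast]
    rw [show l = (l - h) + h by omega, pow_add]
    simp only [Nat.add_sub_cancel]
    push_cast
    rw [Nat.cast_natAbs]
    push_cast
    field_simp
    rw [sq_abs, mul_assoc, ← mul_pow]
    norm_num
  · simp

/-- This bounds the number of digits that the new witness needs by the length of a polynomial-time
output. -/
theorem length_gates_le (V : QCircuit) : V.gates.length ≤ V.encode.length := by
  have key : ∀ gs : List (QGate V.width), gs.length ≤ (gs.flatMap QGate.encode).length := by
    intro gs
    induction gs with
    | nil => simp
    | cons g gs ih =>
      have : 1 ≤ g.encode.length := by cases g <;> simp [QGate.encode]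
      simp only [List.length_cons, List.flatMap_cons, List.length_append]
      omega
  rw [QCircuit.encode, List.length_append]
  exact (key _).trans (Nat.le_add_left _ _)

/-! ### Binary numbers -/

theorem ofBits_encodeNat (n : ℕ) : ofBits (Computability.encodeNat n) = n := by
  have h1 : ∀ p : PosNum, ofBits (Computability.encodePosNum p) = p := by
    intro p
    induction p with
    | one => rfl
    | bit1 p ih =>
      rw [Computability.encodePosNum, ofBits, ih, PosNum.cast_bit1, Bool.toNat_true]; omega
    | bit0 p ih =>
      rw [Computability.encodePosNum, ofBits, ih, PosNum.cast_bit0, Bool.toNat_false]; omega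
  have h2 : ∀ k : Num, ofBits (Computability.encodeNum k) = k := by
    intro k
    cases k with
    | zero => rfl
    | pos p => exact h1 p
  rw [Computability.encodeNat, h2, Num.to_of_nat]

theorem exists_ofBits_eq (l : ℕ) {v : ℕ} (hv : v < 2 ^ l) :
    ∃ w : List Bool, w.length = l ∧ ofBits w = v := by
  induction l generalizing v with
  | zero => exact ⟨[], rfl, by rw [ofBits]; omega⟩
  | succ l ih =>
    rw [pow_succ] at hv
    obtain ⟨w, h1, h2⟩ := ih (v := v / 2) (by omega)
    refine ⟨decide (v % 2 = 1) :: w, by simp [h1], ?_⟩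
    rw [ofBits, h2]
    by_cases h : v % 2 = 1
    · simp [h]; omega
    · simp [h]; omega

theorem ofBits_replicate_append (j : ℕ) (l : List Bool) :
    ofBits (List.replicate j false ++ l) = 2 ^ j * ofBits l := by
  induction j with
  | zero => simp
  | succ j ih =>
    rw [List.replicate_succ, List.cons_append, ofBits, ih, pow_succ, Bool.toNat_false]; ring

/-- A step of the comparison of two numbers, whose digits are read from the least significant one
on: a carry, the remaining digits of the first number and a digit of the second number. -/
def compareStep (e : Bool) (d : Fin 4 × List Bool) : Fin 4 × List Bool :=
  (⟨(d.1.val + (d.2.headD false).toNat + e.toNat + 2) / 2, by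
    have := d.1.isLt
    have := (d.2.headD false).toNat_le
    have := e.toNat_le
    omega⟩, d.2.tail)

/-- The result of a comparison, when the digits of the second number have been read. -/
def compareResult (d : Fin 4 × List Bool) : Bool :=
  decide (d.1.val + (d.2.headD false).toNat ≤ 2)

/-- The inequality keeps its shape when a digit is removed: with r the sum of the carry and the two
lowest digits, r + 2X ≤ 2M + 1 means ⌊r/2⌋ + X ≤ M, that is ⌊(r + 2)/2⌋ + X ≤ M + 1. So the new
carry is (r + 2)/2, and carries up to 3 reproduce themselves. By `ha`, a single digit of `a` is left
at the end. -/
theorem compareResult_foldl {l a : List Bool} {t : Fin 4} (ha : ofBits a < 2 ^ (l.length + 1)) :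
    compareResult (l.foldl (fun d e => compareStep e d) (t, a)) = true ↔
      t.val + ofBits a + ofBits l ≤ 2 ^ l.length + 1 := by
  have hhead : ∀ a : List Bool, ofBits a = (a.headD false).toNat + 2 * ofBits a.tail := by
    intro a
    cases a <;> simp [ofBits]
  induction l generalizing a t with
  | nil =>
    have h1 := hhead a
    simp only [List.length_nil, zero_add, pow_one] at ha
    simp only [List.foldl_nil, ofBits, List.length_nil, pow_zero]
    rw [compareResult, decide_eq_true_iff]
    simp only
    omega
  | cons e l ih =>
    have h1 := hhead a
    rw [List.length_cons, pow_succ] at ha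
    rw [List.foldl_cons, List.length_cons, ofBits, pow_succ]
    refine (ih (by simp only; omega)).trans ?_
    simp only
    have h0 := e.toNat_le
    omega

/-- The test whether `a / 2 ^ k` exceeds `1 - v / 2 ^ l` by at most `1 / 2 ^ k`, where `v` has the
`l` binary digits `w` and `k = l + j`. -/
def compare (j : ℕ) (w a : List Bool) : Bool :=
  compareResult ((List.replicate j false ++ w).foldl (fun d e => compareStep e d) (0, a))

theorem compare_iff {j a : ℕ} {w : List Bool} (ha : a < 2 ^ (j + w.length + 1)) :
    compare j w (Computability.encodeNat a) = true ↔
      a + 2 ^ j * ofBits w ≤ 2 ^ (j + w.length) + 1 := by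
  have hl : (List.replicate j false ++ w).length = j + w.length := by simp
  rw [compare, compareResult_foldl (by rwa [ofBits_encodeNat, hl]), ofBits_encodeNat,
    ofBits_replicate_append, hl]
  simp

/-! ### Estimates -/

/-- The approximation of `c` may exceed one slightly, so its numerator may need one digit more than
`k`. That digit is the one read by `compareResult` after the loop. -/
theorem numerator_lt {c : ℝ} {a k : ℕ} (hc : c ≤ 1) (ha : |c - a / 2 ^ k| ≤ 1 / 2 ^ k)
    (hk : 0 < k) : a < 2 ^ (k + 1) := by
  have h := (abs_le.1 ha).1
  have h2 : (0 : ℝ) < 2 ^ k := by positivity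
  have h3 : (a : ℝ) ≤ 2 ^ k + 1 := by
    have : (a : ℝ) / 2 ^ k ≤ (2 ^ k + 1) / 2 ^ k := by
      rw [add_div, div_self h2.ne']; linarith
    exact (div_le_div_iff_of_pos_right h2).1 this
  have h4 : a ≤ 2 ^ k + 1 := by exact_mod_cast h3
  have h5 : 2 ≤ 2 ^ k := by
    calc 2 = 2 ^ 1 := rfl
      _ ≤ 2 ^ k := Nat.pow_le_pow_right (by norm_num) hk
  rw [pow_succ]
  omega

/-- The honest digits are those of `2 ^ l - N`, where `N / 2 ^ l` is the acceptance probability.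
They fit into `l` places because `N` is positive, which is where `0 < c` enters. -/
theorem exists_compare_of_le {c : ℝ} {V : QCircuit} {a j l : ℕ} (hl : V.gates.length ≤ l)
    (hc : 0 < c) (hc' : c ≤ V.acceptProb) (hj : 0 < j)
    (ha : |c - a / 2 ^ (j + l)| ≤ 1 / 2 ^ (j + l)) :
    ∃ w : List Bool, w.length = l ∧ compare j w (Computability.encodeNat a) = true ∧
      (perfect V w).acceptProb = 1 := by
  obtain ⟨N, hN⟩ := exists_acceptProb_eq V hl
  have h2 : (0 : ℝ) < 2 ^ l := by positivity
  have h3 : (0 : ℝ) < 2 ^ j := by positivity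
  have hV := acceptProb_le_one V
  have hN0 : 0 < N := by
    rcases Nat.eq_zero_or_pos N with h | h
    · subst h; simp at hN; linarith
    · exact h
  have hN1 : N ≤ 2 ^ l := by
    rw [hN, div_le_one h2] at hV
    exact_mod_cast hV
  obtain ⟨w, hw, hv⟩ := exists_ofBits_eq l (v := 2 ^ l - N) (by omega)
  have hv' : (ofBits w : ℝ) = 2 ^ l - N := by rw [hv]; push_cast [hN1]; rfl
  refine ⟨w, hw, ?_, ?_⟩
  · subst hw
    rw [compare_iff (numerator_lt (hc'.trans hV) ha (by omega))]
    have h4 := (abs_le.1 ha).1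
    -- The numerator `a` overshoots the scaled value of `c` by at most one unit; the `+ 1` in the
    -- test allows for it.
    have h5 : (a : ℝ) / 2 ^ (j + w.length) ≤ (2 ^ j * N + 1) / 2 ^ (j + w.length) := by
      have : (N : ℝ) / 2 ^ w.length = 2 ^ j * N / 2 ^ (j + w.length) := by
        rw [pow_add]; field_simp
      rw [add_div, ← this]
      linarith
    rw [div_le_div_iff_of_pos_right (by positivity)] at h5
    have : (a + 2 ^ j * ofBits w : ℝ) ≤ 2 ^ (j + w.length) + 1 := by
      rw [hv', pow_add]; linarith
    exact_mod_cast this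
  · rw [acceptProb_perfect, hw, hN, hv']
    have : 1 - (N : ℝ) / 2 ^ l - (2 ^ l - N) / 2 ^ l = 0 := by field_simp; ring
    rw [this]; norm_num

/-- Exact arithmetic would give 1 - δ² with δ = c - s; this form shows that δ²(1 - δ)/2 is available
for the rounding errors. -/
theorem soundness_eq (c s : ℝ) : 1 / 2 * (1 - (c - s)) * (1 + (1 + c - s) ^ 2) =
    1 - (c - s) ^ 2 * (1 + (c - s)) / 2 := by ring

theorem acceptProb_perfect_le {c s : ℝ} {V : QCircuit} {w : List Bool} {a q : ℕ} (hc : c ≤ 1)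
    (hs : 0 ≤ s) (hq : 0 < q) (hcs : 1 / (q : ℝ) ≤ c - s) (hV : V.acceptProb ≤ s)
    (ha : |c - a / 2 ^ (q + 4 + w.length)| ≤ 1 / 2 ^ (q + 4 + w.length))
    (hw : compare (q + 4) w (Computability.encodeNat a) = true) :
    (perfect V w).acceptProb ≤ 1 / 2 * (1 - (c - s)) * (1 + (1 + c - s) ^ 2) := by
  rw [compare_iff (numerator_lt hc ha (by omega))] at hw
  rw [soundness_eq, acceptProb_perfect]
  obtain ⟨p, hp⟩ : ∃ p, V.acceptProb = p := ⟨_, rfl⟩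
  obtain ⟨v, hv⟩ : ∃ v, ofBits w = v := ⟨_, rfl⟩
  obtain ⟨δ, hδ⟩ : ∃ δ, c - s = δ := ⟨_, rfl⟩
  rw [hp] at hV
  rw [hp, hv, hδ]
  rw [hv] at hw
  rw [hδ] at hcs
  have hq0 : (0 : ℝ) < q := by exact_mod_cast hq
  have hδ0 : 0 < δ := lt_of_lt_of_le (by positivity) hcs
  have hδ1 : δ ≤ 1 := by linarith
  set L : ℝ := 2 ^ w.length with hL
  have hL0 : 0 < L := by positivity
  have hq2 : (q : ℝ) * 16 ≤ 2 ^ (q + 4) := by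
    have : q < 2 ^ q := Nat.lt_two_pow_self
    have : (q : ℝ) ≤ 2 ^ q := by exact_mod_cast this.le
    rw [pow_add]; linarith
  set J : ℝ := 2 ^ (q + 4) with hJ
  have hJ0 : 0 < J := by positivity
  have hJL : (2 : ℝ) ^ (q + 4 + w.length) = J * L := pow_add _ _ _
  rw [hJL] at ha
  have hw' : (a : ℝ) + J * v ≤ J * L + 1 := by
    rw [← hJL, hJ]; exact_mod_cast hw
  -- One unit of error comes from the approximation of `c`, the other from the tolerance of the
  -- test.
  have h1 : c - 2 / (J * L) ≤ 1 - v / L := by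
    have h2 := (abs_le.1 ha).2
    have h3 : (a : ℝ) / (J * L) ≥ c - 1 / (J * L) := by linarith
    have h4 : ((a : ℝ) + J * v) / (J * L) ≤ (J * L + 1) / (J * L) :=
      div_le_div_of_nonneg_right hw' (by positivity)
    rw [add_div, add_div, div_self (by positivity), mul_div_mul_left _ _ hJ0.ne'] at h4
    have : 2 / (J * L) = 1 / (J * L) + 1 / (J * L) := by ring
    linarith
  suffices h : δ ^ 2 * (1 + δ) / 2 ≤ (1 - p - v / L) ^ 2 by linarith
  -- The allowance for rounding vanishes as δ tends to 1. Below the threshold the precision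
  -- suffices; above it, the integrality of `v` removes the rounding error altogether.
  by_cases hcase : 1 / (2 * L) ≤ 1 - δ
  · set ε := 2 / (J * L) with hε
    have hε0 : 0 < ε := by positivity
    -- The left side is 8/(JL), at most 1/(2qL) because J ≥ 16q; this is the reason for the 4 in the
    -- precision `q + 4`. The right side is at least (1/q) · 1/(2L).
    have h2 : 4 * ε ≤ δ * (1 - δ) := by
      have h3 : 1 / (q : ℝ) * (1 / (2 * L)) ≤ δ * (1 - δ) :=
        mul_le_mul hcs hcase (by positivity) hδ0.le
      refine le_trans ?_ h3
      rw [hε, div_mul_div_comm, mul_div_assoc', div_le_div_iff₀ (by positivity) (by positivity)]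
      nlinarith
    have h3 : ε ≤ δ := by nlinarith
    have h4 : δ - ε ≤ 1 - p - v / L := by linarith
    have h5 : (δ - ε) ^ 2 ≤ (1 - p - v / L) ^ 2 := pow_le_pow_left₀ (by linarith) h4 2
    -- (δ - ε)² ≥ δ² - 2δε ≥ δ² - δ²(1 - δ)/2 = δ²(1 + δ)/2.
    nlinarith
  · push Not at hcase
    -- Since c ≥ δ > 1 - 1/(2L), the test leaves v/L less than 1/(2L) plus the error 2/(JL) ≤
    -- 1/(2L).
    have hv0 : v = 0 := by
      have h2 : 2 / (J * L) ≤ 1 / (2 * L) := by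
        rw [div_le_div_iff₀ (by positivity) (by positivity)]
        have : (1 : ℝ) ≤ q := by exact_mod_cast hq
        nlinarith
      have h3 : (v : ℝ) / L < 1 / L := by
        have : 1 / L = 1 / (2 * L) + 1 / (2 * L) := by field_simp; norm_num
        linarith
      rw [div_lt_div_iff_of_pos_right hL0] at h3
      have : v < 1 := by exact_mod_cast h3
      omega
    subst hv0
    have h2 : δ ≤ 1 - p - (0 : ℕ) / L := by simp; linarith
    have h3 := pow_le_pow_left₀ hδ0.le h2 2
    nlinarith

end PerfectCompleteness

/-! ### Descriptions of circuits -/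

namespace PerfectCompleteness

open PolyTime

noncomputable instance : Fintype CircuitSymbol :=
  Fintype.ofInjective (β := Fin 5)
    (fun | .tick => 0 | .sep => 1 | .hadamard => 2 | .not => 3 | .toffoli => 4)
    (by rintro ⟨⟩ ⟨⟩ h <;> first | rfl | simp at h)

variable {n m : ℕ}

def hadamardWord (i : ℕ) : List CircuitSymbol := .hadamard :: encodeIndex i

def notWord (i : ℕ) : List CircuitSymbol := .not :: encodeIndex i

def toffoliWord (i j t : ℕ) : List CircuitSymbol :=
  .toffoli :: (encodeIndex i ++ encodeIndex j ++ encodeIndex t)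

/-- The description of the gates of a coin step. -/
def coinWord (b : Bool) (j : ℕ) : List CircuitSymbol :=
  hadamardWord (j + 1) ++ (if b then notWord j else []) ++ toffoliWord (j + 1) j (j + 2) ++
    (if b then notWord (j + 2) else [])

theorem flatMap_coinStep {j : ℕ} (h : j + 2 < n) (b : Bool) :
    (coinStep j h b).flatMap QGate.encode = coinWord b j := by
  cases b <;> simp [coinStep, coinWord, QGate.encode, hadamardWord, notWord, toffoliWord]

/-- The description of the gates of a ladder. -/
def ladderWord (j : ℕ) (l : List Bool) : List CircuitSymbol :=
  emit (fun b z => coinWord b z.length) [true, true] (List.replicate j true) l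

theorem flatMap_ladder {j : ℕ} {l : List Bool} (h : j + 2 * l.length < n) :
    (ladder n j l h).flatMap QGate.encode = ladderWord j l := by
  induction l generalizing j with
  | nil => rfl
  | cons b l ih =>
    rw [ladder, List.flatMap_append, flatMap_coinStep, ih, ladderWord, ladderWord, emit,
      List.length_replicate, List.replicate_add]
    rfl

/-- The description of the gates of a mixing step. -/
def mixWord (j o : ℕ) : List CircuitSymbol :=
  hadamardWord (j + 1) ++ toffoliWord (j + 1) o (j + 2) ++ notWord (j + 1) ++
    toffoliWord (j + 1) j (j + 2)

theorem flatMap_mixStep {j : ℕ} (h : j + 2 < n) {o : ℕ} (ho : o < j) :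
    (mixStep j h o ho).flatMap QGate.encode = mixWord j o := by
  simp [mixStep, mixWord, QGate.encode, hadamardWord, notWord, toffoliWord]

/-- The description of the gates of the final check. -/
def checkWord (m : ℕ) : List CircuitSymbol :=
  notWord m ++ emit (fun (_ : Bool) z => notWord (z.count true) ++
    toffoliWord (z.count true) z.length (z.length + 1)) [true] (List.replicate m false)
    (List.replicate m true) ++ notWord (2 * m)

theorem flatMap_check (m : ℕ) : (check m).flatMap QGate.encode = checkWord m := by
  -- One counter word holds both indices: after `m` times `false` and `i` times `true`, the number
  -- of `true` is the qubit `i` and the length is the flag `m + i`.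
  have key : ∀ (k i : ℕ) (h : i + k ≤ m), (checkSteps m i k h).flatMap QGate.encode =
      emit (fun (_ : Bool) z => notWord (z.count true) ++
        toffoliWord (z.count true) z.length (z.length + 1)) [true]
        (List.replicate m false ++ List.replicate i true) (List.replicate k true) := by
    intro k
    induction k with
    | zero => intros; rfl
    | succ k ih =>
      intro i h
      rw [checkSteps, List.flatMap_append, ih, List.replicate_succ (n := k), emit,
        List.append_assoc (List.replicate m false), ← List.replicate_succ']
      congr 1
      simp [checkStep, QGate.encode, notWord, toffoliWord, List.count_replicate, add_assoc]
  rw [check, List.flatMap_append, List.flatMap_append, key, checkWord]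
  simp [QGate.encode, notWord]

/-- The symbol begins the description of a gate. -/
def isKind : CircuitSymbol → Bool
  | .tick => false
  | .sep => false
  | _ => true

/-- A step in the reversal of a list of gates: the gate that is read at present, and the gates
before it in reverse order. -/
def reverseStep (a : CircuitSymbol) (d : List CircuitSymbol × List CircuitSymbol) :
    List CircuitSymbol × List CircuitSymbol :=
  if isKind a then ([a], d.1 ++ d.2) else (d.1 ++ [a], d.2)

/-- The description of a list of gates in reverse order. -/
def reverseWord (l : List CircuitSymbol) : List CircuitSymbol :=
  (l.foldl (fun d a => reverseStep a d) ([], [])).1 ++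
    (l.foldl (fun d a => reverseStep a d) ([], [])).2

theorem foldl_reverseStep_encodeIndex (i : ℕ) (u v : List CircuitSymbol) :
    (encodeIndex i).foldl (fun d a => reverseStep a d) (u, v) = (u ++ encodeIndex i, v) := by
  have key : ∀ l : List CircuitSymbol, (∀ a ∈ l, isKind a = false) → ∀ u,
      l.foldl (fun d a => reverseStep a d) (u, v) = (u ++ l, v) := by
    intro l
    induction l with
    | nil => simp
    | cons a l ih =>
      intro h u
      rw [List.foldl_cons, reverseStep, h a List.mem_cons_self, if_neg Bool.false_ne_true,
        ih fun a ha => h a (List.mem_cons_of_mem _ ha)]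
      simp
  refine key _ (fun a ha => ?_) u
  rw [encodeIndex, List.mem_append, List.mem_singleton] at ha
  rcases ha with ha | rfl
  · rw [(List.mem_replicate.1 ha).2]; rfl
  · rfl

theorem foldl_reverseStep_encode (g : QGate n) (u v : List CircuitSymbol) :
    g.encode.foldl (fun d a => reverseStep a d) (u, v) = (g.encode, u ++ v) := by
  have h1 : reverseStep .hadamard (u, v) = ([.hadamard], u ++ v) := rfl
  have h2 : reverseStep .not (u, v) = ([.not], u ++ v) := rfl
  have h3 : reverseStep .toffoli (u, v) = ([.toffoli], u ++ v) := rfl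
  cases g <;>
  simp [QGate.encode, List.foldl_append, foldl_reverseStep_encodeIndex, h1, h2, h3]

/-- A kind symbol occurs at the beginning of each gate description and nowhere else, so a single
pass can cut the word into gates and prepend each finished gate to those before it. -/
theorem reverseWord_flatMap (gs : List (QGate n)) :
    reverseWord (gs.flatMap QGate.encode) = gs.reverse.flatMap QGate.encode := by
  have key : ∀ (gs : List (QGate n)) (d : List CircuitSymbol × List CircuitSymbol),
      ((gs.flatMap QGate.encode).foldl (fun d a => reverseStep a d) d).1 ++
        ((gs.flatMap QGate.encode).foldl (fun d a => reverseStep a d) d).2 =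
      gs.reverse.flatMap QGate.encode ++ (d.1 ++ d.2) := by
    intro gs
    induction gs with
    | nil => simp
    | cons g gs ih =>
      intro d
      rw [List.flatMap_cons, List.foldl_append, foldl_reverseStep_encode, ih]
      simp
  simpa [reverseWord] using key gs ([], [])

/-- The description of the gates of a circuit that computes a mixture. -/
def mixtureWord (N o : ℕ) (gs : List CircuitSymbol) (l : List Bool) : List CircuitSymbol :=
  gs ++ ladderWord N l ++ mixWord (N + 2 * l.length) o

/-- The description of a rewinding circuit. -/
def rewindWord (M y : ℕ) (gs : List CircuitSymbol) : List CircuitSymbol :=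
  encodeIndex (2 * M + 1) ++ encodeIndex (2 * M) ++
    (gs ++ (hadamardWord y ++ notWord y ++ hadamardWord y) ++ reverseWord gs ++ checkWord M)

theorem flatMap_encode_map_lift (h : n ≤ m) (gs : List (QGate n)) :
    (gs.map (lift h)).flatMap QGate.encode = gs.flatMap QGate.encode := by
  rw [List.flatMap_map]
  simp only [encode_lift]

theorem encode_perfect (V : QCircuit) (l : List Bool) :
    (perfect V l).encode = rewindWord (V.width + 2 * l.length + 3) (V.width + 2 * l.length + 2)
      (mixtureWord V.width V.output (V.gates.flatMap QGate.encode) l) := by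
  have h : (mixture V l).flatMap QGate.encode =
      mixtureWord V.width V.output (V.gates.flatMap QGate.encode) l := by
    rw [mixture, List.flatMap_append, List.flatMap_append, flatMap_encode_map_lift, flatMap_ladder,
      flatMap_mixStep, mixtureWord]
  rw [rewindWord, ← h, reverseWord_flatMap, ← flatMap_check]
  simp only [QCircuit.encode, perfect, rewind, List.flatMap_append, flatMap_encode_map_lift]
  simp [QGate.encode, hadamardWord, notWord]

/-! ### The computation of descriptions -/

variable {α A₀ : Type} [Fintype A₀] {ea : α → List A₀} {u v w : α → ℕ}

theorem wordComputable_encodeIndex (hu : WordComputable ea fun x => List.replicate (u x) true) :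
    WordComputable ea fun x => encodeIndex (u x) := by
  simpa [encodeIndex] using (hu.map fun _ => CircuitSymbol.tick).append (.const [.sep])

theorem wordComputable_hadamardWord (hu : WordComputable ea fun x => List.replicate (u x) true) :
    WordComputable ea fun x => hadamardWord (u x) :=
  (WordComputable.const [CircuitSymbol.hadamard]).append (wordComputable_encodeIndex hu)

theorem wordComputable_notWord (hu : WordComputable ea fun x => List.replicate (u x) true) :
    WordComputable ea fun x => notWord (u x) :=
  (WordComputable.const [CircuitSymbol.not]).append (wordComputable_encodeIndex hu)

theorem wordComputable_toffoliWord (hu : WordComputable ea fun x => List.replicate (u x) true)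
    (hv : WordComputable ea fun x => List.replicate (v x) true)
    (hw : WordComputable ea fun x => List.replicate (w x) true) :
    WordComputable ea fun x => toffoliWord (u x) (v x) (w x) :=
  (WordComputable.const [CircuitSymbol.toffoli]).append (((wordComputable_encodeIndex hu).append
    (wordComputable_encodeIndex hv)).append (wordComputable_encodeIndex hw))

theorem wordComputable_add_const (hu : WordComputable ea fun x => List.replicate (u x) true)
    (k : ℕ) : WordComputable ea fun x => List.replicate (u x + k) true :=
  hu.replicate_add (.const _)

theorem wordComputable_const_mul (hu : WordComputable ea fun x => List.replicate (u x) true)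
    (k : ℕ) : WordComputable ea fun x => List.replicate (k * u x) true :=
  (WordComputable.const (List.replicate k true)).replicate_mul hu

theorem wordComputable_ladderWord {l : α → List Bool}
    (hu : WordComputable ea fun x => List.replicate (u x) true) (hl : WordComputable ea l) :
    WordComputable ea fun x => ladderWord (u x) (l x) := by
  refine WordComputable.emit _ ?_ hl hu
  have hb := WordComputable.step_letter (A := Bool) (eS := (id : List Bool → List Bool))
  have hz := (WordComputable.step_state (A := Bool) (eS := (id : List Bool → List Bool))
    ).length_replicate true
  exact (((wordComputable_hadamardWord (wordComputable_add_const hz 1)).append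
    (hb.ite (wordComputable_notWord hz) (.const []))).append
    (wordComputable_toffoliWord (wordComputable_add_const hz 1) hz
      (wordComputable_add_const hz 2))).append
    (hb.ite (wordComputable_notWord (wordComputable_add_const hz 2)) (.const []))

theorem wordComputable_mixWord (hu : WordComputable ea fun x => List.replicate (u x) true)
    (hv : WordComputable ea fun x => List.replicate (v x) true) :
    WordComputable ea fun x => mixWord (u x) (v x) := by
  have h1 := wordComputable_add_const hu 1
  have h2 := wordComputable_add_const hu 2
  exact (((wordComputable_hadamardWord h1).append (wordComputable_toffoliWord h1 hv h2)).append
    (wordComputable_notWord h1)).append (wordComputable_toffoliWord h1 hu h2)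

theorem wordComputable_checkWord (hu : WordComputable ea fun x => List.replicate (u x) true) :
    WordComputable ea fun x => checkWord (u x) := by
  refine ((wordComputable_notWord hu).append ?_).append
    (wordComputable_notWord (wordComputable_const_mul hu 2))
  refine WordComputable.emit _ ?_ hu (by simpa using hu.map fun _ => false)
  have hs := WordComputable.step_state (A := Bool) (eS := (id : List Bool → List Bool))
  have hz := hs.length_replicate true
  have hc : WordComputable (fun p : Bool × List Bool => Sum.inl p.1 :: (id p.2).map Sum.inr)
      fun p => List.replicate (p.2.count true) true := by
    have key : ∀ z : List Bool, z.flatMap (fun b => if b then [true] else []) =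
        List.replicate (z.count true) true := by
      intro z
      induction z with
      | nil => rfl
      | cons b z ih => cases b <;> simp [ih, List.replicate_succ]
    simpa only [key, id] using hs.flatMap fun b => if b then [true] else []
  exact (wordComputable_notWord hc).append
    (wordComputable_toffoliWord hc hz (wordComputable_add_const hz 1))

theorem wordComputable_reverseWord {F : α → List CircuitSymbol} (hF : WordComputable ea F) :
    WordComputable ea fun x => reverseWord (F x) := by
  have hstep : WordComputable (fun p : CircuitSymbol × (List CircuitSymbol × List CircuitSymbol) =>
      Sum.inl p.1 :: (pairWord p.2).map Sum.inr) fun p => pairWord (reverseStep p.1 p.2) := by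
    have h := WordComputable.step_state (A := CircuitSymbol)
      (eS := pairWord (B := CircuitSymbol) (C := CircuitSymbol))
    have ha := WordComputable.step_letter (A := CircuitSymbol)
      (eS := pairWord (B := CircuitSymbol) (C := CircuitSymbol))
    have := (ha.map isKind).ite (ha.pair (h.pairWord_left.append h.pairWord_right))
      ((h.pairWord_left.append ha).pair h.pairWord_right)
    refine (congrArg _ (funext fun p => ?_)).mp this
    rw [reverseStep, apply_ite pairWord]
    rfl
  have := WordComputable.foldl_of_length_le (eS := pairWord)
    (d := fun _ => (([], []) : List CircuitSymbol × List CircuitSymbol)) hF (.const []) hstep 1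
    (fun a d => by
      rw [reverseStep]
      split <;> simp [length_pairWord] <;> omega)
  exact this.pairWord_left.append this.pairWord_right

theorem wordComputable_mixtureWord {F : α → List CircuitSymbol} {l : α → List Bool}
    (hu : WordComputable ea fun x => List.replicate (u x) true)
    (hv : WordComputable ea fun x => List.replicate (v x) true)
    (hF : WordComputable ea F) (hl : WordComputable ea l) :
    WordComputable ea fun x => mixtureWord (u x) (v x) (F x) (l x) :=
  (hF.append (wordComputable_ladderWord hu hl)).append (wordComputable_mixWord
    (hu.replicate_add (wordComputable_const_mul (hl.length_replicate true) 2)) hv)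

theorem wordComputable_rewindWord {F : α → List CircuitSymbol}
    (hu : WordComputable ea fun x => List.replicate (u x) true)
    (hv : WordComputable ea fun x => List.replicate (v x) true) (hF : WordComputable ea F) :
    WordComputable ea fun x => rewindWord (u x) (v x) (F x) := by
  have h2 := wordComputable_const_mul hu 2
  have hH := wordComputable_hadamardWord hv
  exact ((wordComputable_encodeIndex (wordComputable_add_const h2 1)).append
    (wordComputable_encodeIndex h2)).append (((hF.append ((hH.append
      (wordComputable_notWord hv)).append hH)).append (wordComputable_reverseWord hF)).append
      (wordComputable_checkWord hu))

/-- The symbol is a tick. -/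
def isTick : CircuitSymbol → Bool
  | .tick => true
  | _ => false

theorem takeWhile_encodeIndex (i : ℕ) (l : List CircuitSymbol) :
    (encodeIndex i ++ l).takeWhile isTick = List.replicate i .tick := by
  induction i with
  | zero => simp [encodeIndex, isTick]
  | succ i ih =>
    have h : isTick .tick = true := rfl
    simpa [encodeIndex, List.replicate_succ, h] using ih

theorem tail_dropWhile_encodeIndex (i : ℕ) (l : List CircuitSymbol) :
    ((encodeIndex i ++ l).dropWhile isTick).tail = l := by
  induction i with
  | zero => simp [encodeIndex, isTick]
  | succ i ih =>
    have h : isTick .tick = true := rfl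
    simpa [encodeIndex, List.replicate_succ, h] using ih

/-- The width, the output qubit and the word of the gates are recovered from the old description by
cutting at its first two separators. -/
theorem wordComputable_perfect {V : α → QCircuit} {l : α → List Bool}
    (hV : WordComputable ea fun x => (V x).encode) (hl : WordComputable ea l) :
    WordComputable ea fun x => (perfect (V x) (l x)).encode := by
  have hw : WordComputable ea fun x => List.replicate (V x).width true := by
    simpa [QCircuit.encode, takeWhile_encodeIndex] using
      (hV.takeWhile isTick).map fun _ => true
  have hr : WordComputable ea fun x => encodeIndex (V x).output ++
      (V x).gates.flatMap QGate.encode := by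
    simpa [QCircuit.encode, tail_dropWhile_encodeIndex] using (hV.dropWhile isTick).tail
  have ho : WordComputable ea fun x => List.replicate (V x).output.val true := by
    simpa [takeWhile_encodeIndex] using (hr.takeWhile isTick).map fun _ => true
  have hg : WordComputable ea fun x => (V x).gates.flatMap QGate.encode := by
    simpa [tail_dropWhile_encodeIndex] using (hr.dropWhile isTick).tail
  have h := hw.replicate_add (wordComputable_const_mul (hl.length_replicate true) 2)
  simpa only [encode_perfect] using wordComputable_rewindWord (wordComputable_add_const h 3)
    (wordComputable_add_const h 2) (wordComputable_mixtureWord hw ho hg hl)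

/-- The encoding of the state of a comparison. -/
def encodeCompare (d : Fin 4 × List Bool) : List (Fin 4 ⊕ Bool) := .inl d.1 :: d.2.map .inr

theorem wordComputable_compare {l a : α → List Bool}
    (hu : WordComputable ea fun x => List.replicate (u x) true) (hl : WordComputable ea l)
    (ha : WordComputable ea a) : WordComputable ea fun x => [compare (u x) (l x) (a x)] := by
  have hstep : WordComputable (fun p : Bool × (Fin 4 × List Bool) =>
      Sum.inl p.1 :: (encodeCompare p.2).map Sum.inr)
      fun p => encodeCompare (compareStep p.1 p.2) := by
    have h := WordComputable.step_state (A := Bool) (eS := encodeCompare)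
    have ht : WordComputable (fun p : Bool × (Fin 4 × List Bool) =>
        Sum.inl p.1 :: (encodeCompare p.2).map Sum.inr) fun p => p.2.2.tail := by
      simpa [encodeCompare, List.flatMap_map] using
        (h.tail.flatMap (Sum.elim (fun _ => []) fun b => [b])).tail
    -- The new carry depends on the digit read, the old carry and at most one further digit, hence
    -- on three letters; a missing digit counts as zero.
    let f : List (Bool ⊕ (Fin 4 ⊕ Bool)) → List (Fin 4)
      | [.inl e, .inr (.inl t)] => [(compareStep e (t, [])).1]
      | [.inl e, .inr (.inl t), .inr (.inr b)] => [(compareStep e (t, [b])).1]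
      | _ => []
    refine (congrArg _ (funext fun p => ?_)).mp ((WordComputable.self.lookup 3 f).pair ht)
    obtain ⟨e, t, _ | ⟨b, l⟩⟩ := p <;> rfl
  have hd : WordComputable ea fun x => encodeCompare (0, a x) :=
    (WordComputable.const [(0 : Fin 4)]).pair ha
  have hL : WordComputable ea fun x => List.replicate (u x) false ++ l x :=
    WordComputable.append (by simpa using hu.map fun _ => false) hl
  have := WordComputable.foldl_of_length_le hL hd hstep 0 (fun e d => by
    simp [encodeCompare, compareStep])
  let f : List (Fin 4 ⊕ Bool) → List Bool
    | [.inl t] => [compareResult (t, [])]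
    | [.inl t, .inr b] => [compareResult (t, [b])]
    | _ => []
  refine (congrArg _ (funext fun x => ?_)).mp (this.lookup 2 f)
  rw [compare]
  generalize List.foldl _ _ _ = d
  obtain ⟨t, _ | ⟨b, l⟩⟩ := d <;> rfl

end PerfectCompleteness

/-! ### The new verifier and the inclusion of classes -/

namespace PerfectCompleteness

open PolyTime

theorem pairWord_eq_encodePair (p : List Bool × List Bool) : pairWord p = encodePair p := rfl

/-- The first part of a witness. -/
def firstPart {m m' : ℕ → ℕ} (h : ∀ n, m n ≤ m' n) (p : WitnessPair m') : WitnessPair m :=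
  ⟨(p.1.1, p.1.2.take (m p.1.1.length)), by
    rw [List.length_take, p.2]; exact min_eq_left (h _)⟩

/-- The witness is cut into the old witness and the digits. The test is classical, so it is decided
while the description is written, and failure simply produces the rejecting circuit. -/
theorem polyTimeComputable_verifier {m m' q : ℕ → ℕ} (h : ∀ n, m n ≤ m' n)
    (hm : PolynomiallyBounded m) (hq : PolynomiallyBounded q)
    {V : WitnessPair m → QCircuit}
    (hV : PolyTimeComputable (fun p : WitnessPair m => encodePair p.1) QCircuit.encode V)
    {a : ℕ × ℕ → ℕ} (ha : PolyTimeComputable encodeUnaryPair Computability.encodeNat a) :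
    PolyTimeComputable (fun p : WitnessPair m' => encodePair p.1) QCircuit.encode fun p =>
      if compare (q p.1.1.length + 4) (p.1.2.drop (m p.1.1.length)) (Computability.encodeNat
        (a (p.1.1.length, q p.1.1.length + 4 + (p.1.2.drop (m p.1.1.length)).length)))
      then perfect (V (firstPart h p)) (p.1.2.drop (m p.1.1.length)) else reject := by
  apply WordComputable.polyTimeComputable
  simp only [apply_ite QCircuit.encode]
  have h0 : WordComputable (fun p : WitnessPair m' => encodePair p.1) fun p => pairWord p.1 :=
    WordComputable.self
  have hx := h0.pairWord_left
  have hn := hx.length_replicate true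
  have hmn := hn.replicate_apply hm
  have hw := hmn.take h0.pairWord_right
  have hB := hmn.drop h0.pairWord_right
  have hj := wordComputable_add_const (hn.replicate_apply hq) 4
  have hk := hj.replicate_add (hB.length_replicate true)
  have hc := WordComputable.apply (ea := fun p : WitnessPair m' => encodePair p.1) ha
    (f := fun p => (p.1.1.length, q p.1.1.length + 4 + (p.1.2.drop (m p.1.1.length)).length)) (by
      have := hn.pair hk
      simp only [← WordComputable.unaryEncodeNat_eq] at this
      exact this)
  have hC := WordComputable.apply (ea := fun p : WitnessPair m' => encodePair p.1) hV
    (f := firstPart h) (hx.pair hw)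
  exact (wordComputable_compare hj hB hc).ite (wordComputable_perfect hC hB) (.const _)

/-- The new witness length: `p` will bound the length of the description of `V`, hence its number of
gates, in terms of the input length `n + m n`. -/
theorem polynomiallyBounded_add_eval {m : ℕ → ℕ} (hm : PolynomiallyBounded m)
    (p : Polynomial ℕ) : PolynomiallyBounded fun n => m n + p.eval (n + m n) := by
  refine ⟨fun n => Nat.add_pos_left (hm.1 n) _, WordComputable.polyTimeComputable ?_⟩
  have hn : WordComputable Computability.unaryEncodeNat fun n => List.replicate n true :=
    (congrArg _ (funext WordComputable.unaryEncodeNat_eq)).mp WordComputable.self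
  have h := hn.replicate_apply hm
  simpa only [WordComputable.unaryEncodeNat_eq] using
    h.replicate_add (WordComputable.replicate_eval p (hn.replicate_add h))

theorem qcma_subset {c s s' : ℕ → ℝ} (hc : ∀ n, c n ≤ 1) (hs : ∀ n, 0 ≤ s n)
    (hcomp : PolyTimeComputableReal c) {q : ℕ → ℕ} (hq : PolynomiallyBounded q)
    (hgap : ∀ n, 1 / (q n : ℝ) ≤ c n - s n)
    (hs' : ∀ n, s' n = 1 / 2 * (1 - (c n - s n)) * (1 + (1 + c n - s n) ^ 2))
    (hs'' : ∀ n, 0 ≤ s' n) : QCMA c s ⊆ QCMA (fun _ => 1) s' := by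
  rintro A ⟨m, hm, V, hV, hA⟩
  obtain ⟨a, ha, hca⟩ := hcomp
  obtain ⟨p, hp⟩ := output_length_le hV
  have hm' := polynomiallyBounded_add_eval hm p
  have hle : ∀ n, m n ≤ m n + p.eval (n + m n) := fun n => Nat.le_add_right _ _
  refine ⟨_, hm', _, polyTimeComputable_verifier hle hm hq hV ha, fun x => ⟨fun hx => ?_,
    fun hx w' hw' => ?_⟩⟩
  · obtain ⟨w, hw, hacc⟩ := (hA x).1 hx
    have hl : (V ⟨(x, w), hw⟩).gates.length ≤ p.eval (x.length + m x.length) := by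
      refine (length_gates_le _).trans ((hp ⟨(x, w), hw⟩).trans (le_of_eq ?_))
      rw [← pairWord_eq_encodePair, length_pairWord]
      simp only [hw]
    have hc0 : 0 < c x.length := by
      have : 0 < 1 / (q x.length : ℝ) := one_div_pos.2 (Nat.cast_pos.2 (hq.1 _))
      linarith [hgap x.length, hs x.length]
    obtain ⟨B, hB, hcmp, hone⟩ := exists_compare_of_le hl hc0 hacc
      (show 0 < q x.length + 4 by omega) (hca _ _)
    refine ⟨w ++ B, by rw [List.length_append, hw, hB], ?_⟩
    simp only [firstPart, List.take_left' hw, List.drop_left' hw, hB, hcmp, if_true, hone, le_refl]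
  -- Soundness does not need the number of digits to match the circuit: `acceptProb_perfect_le`
  -- holds for digit strings of any length.
  · split
    · rename_i hcmp
      rw [hs']
      exact acceptProb_perfect_le (hc _) (hs _) (hq.1 _) (hgap _)
        ((hA x).2 hx _ (firstPart hle ⟨(x, w'), hw'⟩).2) (hca _ _) hcmp
    · rw [acceptProb_reject]
      exact hs'' _

end PerfectCompleteness

theorem theorem2 (c s : ℕ → ℝ)
    (hc : ∀ n, c n ∈ Set.Icc (0 : ℝ) 1) (hs : ∀ n, s n ∈ Set.Icc (0 : ℝ) 1)
    (hcomp : PolyTimeComputableReal c)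
    (hgap : ∃ q : ℕ → ℕ, PolynomiallyBounded q ∧ ∀ n, 1 / (q n : ℝ) ≤ c n - s n)
    (s' : ℕ → ℝ)
    (hs' : ∀ n, s' n = 1 / 2 * (1 - (c n - s n)) * (1 + (1 + c n - s n) ^ 2)) :
    (∀ n, 0 ≤ s' n ∧ s' n < 1) ∧ QCMA c s ⊆ QCMA (fun _ => 1) s' := by
  obtain ⟨q, hq, hgap⟩ := hgap
  have h : ∀ n, 0 ≤ s' n ∧ s' n < 1 := by
    intro n
    have hpos : 0 < c n - s n :=
      lt_of_lt_of_le (one_div_pos.2 (Nat.cast_pos.2 (hq.1 n))) (hgap n)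
    have hle : c n - s n ≤ 1 := by linarith [(hc n).2, (hs n).1]
    rw [hs']
    refine ⟨mul_nonneg (by linarith) (by positivity), ?_⟩
    rw [PerfectCompleteness.soundness_eq]
    have : 0 < (c n - s n) ^ 2 * (1 + (c n - s n)) / 2 := by positivity
    linarith
  exact ⟨h, PerfectCompleteness.qcma_subset (fun n => (hc n).2) (fun n => (hs n).1) hcomp hq hgap
    hs' fun n => (h n).1⟩
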